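/- Let $\beta\in\mathbf{R}$ with $\beta^2>0$, and let $\Omega\subset\mathbf{R}^2\simeq\mathbf{C}$ be a convex polygon with $n\ge 3$ vertices $z_1,\dots,z_n$, listed counterclockwise (indices modulo $n$; no three vertices collinear), and with sides $\Gamma_j$ from $z_j$ to $z_{j+1}$. Let $|\Gamma_j|=|z_{j+1}-z_j|$, $\alpha_j=\arg(z_{j+1}-z_j)$, $\psi_j(\tau)=\tau z_{j+1}+(1-\tau)z_j$ for $\tau\in[0,1]$, and $\psi_j^*f=f\circ\psi_j$. Let $\mathcal{E}[0,1]$ be the Fréchet space of smooth functions $[0,1]\to\mathbf{C}$ (smooth up to the end points), with the seminorms $\delta_m(\varphi)=\max_{[0,1]}|\varphi^{(m)}|$, $m\ge 0$, and let $\mathcal{E}'[0,1]$ be its topological dual. The natural extension of $u\in\mathcal{E}'[0,1]$ to $\mathbf{R}$ is the compactly supported distribution $f\mapsto\langle u,f|_{[0,1]}\rangle$. For $r\in\mathbf{R}$, write $u\in H^r_{\mathrm{loc}}(0,1)$ if $\varphi u\in H^r(\mathbf{R})$ for every $\varphi\in C_c^\infty(0,1)$, where $u$ is identified with its natural extension.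 **Theorem 4.1.** Suppose that $q_j,\partial_{\mathbf n}q_j\in\mathcal{E}'[0,1]$ ($j=1,\dots,n$) are distributions (two arbitrary families; $\partial_{\mathbf n}q_j$ is only a name for the second one) such that the global relation $$\sum_{j=1}^n\rho_j(\lambda)=0\qquad\text{for all }\lambda\in\mathbf{C}\setminus\{0\}$$ is satisfied, where $$\frac{\rho_j(\lambda)}{|\Gamma_j|}=\Big\langle\partial_{\mathbf n}q_j,\psi_j^*\big(e^{-\mathrm{i}\lambda z+\mathrm{i}\beta^2\bar z/\lambda}\big)\Big\rangle+\Big(\lambda e^{\mathrm{i}\alpha_j}+\frac{\beta^2}{\lambda e^{\mathrm{i}\alpha_j}}\Big)\Big\langle q_j,\psi_j^*\big(e^{-\mathrm{i}\lambda z+\mathrm{i}\beta^2\bar z/\lambda}\big)\Big\rangle .$$ Let $1\le i\le n$ and $s\in\mathbf{R}$, and suppose that the natural extension of $q_i$ to $\mathbf{R}$ belongs to $H^s(\mathbf{R})$. Then $\partial_{\mathbf n}q_i\in H^{s-1}_{\mathrm{loc}}(0,1)$. -/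

import Mathlib

open Set
open scoped ContDiff SchwartzMap ComplexConjugate

noncomputable section

/-! ### The Fréchet space of smooth functions on `[0,1]` and its dual -/

/-- The functions `[0,1] → ℂ` that are smooth up to the boundary (one-sided derivatives at the
end points), as a subspace of all functions. `IccExtend` only serves to regard a function on
`[0,1]` as a function on `ℝ`; its values off `[0,1]` play no role in `ContDiffOn _ _ _ (Icc 0 1)`. -/
def smoothUnitSubmodule : Submodule ℂ (Icc (0 : ℝ) 1 → ℂ) where
  carrier := {f | ContDiffOn ℝ ∞ (IccExtend (zero_le_one' ℝ) f) (Icc 0 1)}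
  zero_mem' := by
    have : IccExtend (zero_le_one' ℝ) (0 : Icc (0 : ℝ) 1 → ℂ) = fun _ => 0 := rfl
    simpa [this] using contDiffOn_const
  add_mem' := fun hf hg => ContDiffOn.add hf hg
  smul_mem' := fun c _ hf => ContDiffOn.const_smul c hf

/-- The space `ℰ[0,1]` of smooth functions `[0,1] → ℂ`. -/
def SmoothUnit : Type := smoothUnitSubmodule

namespace SmoothUnit

instance : AddCommGroup SmoothUnit := inferInstanceAs (AddCommGroup smoothUnitSubmodule)

instance : Module ℂ SmoothUnit := inferInstanceAs (Module ℂ smoothUnitSubmodule)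

/-- A smooth function on `[0,1]`, regarded as a function on `ℝ` (constant outside `[0,1]`). -/
def ext (f : SmoothUnit) : ℝ → ℂ := IccExtend (zero_le_one' ℝ) f.1

theorem contDiffOn_ext (f : SmoothUnit) : ContDiffOn ℝ ∞ f.ext (Icc 0 1) := f.2

/-- The `n`-th derivative of a smooth function on `[0,1]` (one-sided at the end points). -/
def deriv (n : ℕ) (f : SmoothUnit) (τ : Icc (0 : ℝ) 1) : ℂ :=
  iteratedDerivWithin n f.ext (Icc 0 1) τ

theorem deriv_add (n : ℕ) (f g : SmoothUnit) (τ : Icc (0 : ℝ) 1) :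
    (f + g).deriv n τ = f.deriv n τ + g.deriv n τ := by
  have h : (n : WithTop ℕ∞) ≤ ∞ := mod_cast le_top
  exact iteratedDerivWithin_add τ.2 (uniqueDiffOn_Icc_zero_one)
    ((f.contDiffOn_ext.of_le h) τ τ.2) ((g.contDiffOn_ext.of_le h) τ τ.2)

theorem deriv_smul (n : ℕ) (c : ℂ) (f : SmoothUnit) (τ : Icc (0 : ℝ) 1) :
    (c • f).deriv n τ = c * f.deriv n τ := by
  have h : (n : WithTop ℕ∞) ≤ ∞ := mod_cast le_top
  exact iteratedDerivWithin_const_smul τ.2 (uniqueDiffOn_Icc_zero_one) c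
    ((f.contDiffOn_ext.of_le h) τ τ.2)

theorem bddAbove_deriv (n : ℕ) (f : SmoothUnit) :
    BddAbove (range fun τ : Icc (0 : ℝ) 1 => ‖f.deriv n τ‖) := by
  have h : (n : WithTop ℕ∞) ≤ ∞ := mod_cast le_top
  have hc := (f.contDiffOn_ext.continuousOn_iteratedDerivWithin h uniqueDiffOn_Icc_zero_one).norm
  exact isCompact_range (continuousOn_iff_continuous_domRestrict.1 hc) |>.bddAbove

/-- The seminorm `δ_n(f) = max_{τ ∈ [0,1]} |f⁽ⁿ⁾(τ)|`. -/
def seminorm (n : ℕ) : Seminorm ℂ SmoothUnit :=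
  Seminorm.of (fun f => ⨆ τ : Icc (0 : ℝ) 1, ‖f.deriv n τ‖)
    (fun f g => ciSup_le fun τ => by
      rw [deriv_add]
      exact (norm_add_le _ _).trans
        (add_le_add (le_ciSup (f.bddAbove_deriv n) τ) (le_ciSup (g.bddAbove_deriv n) τ)))
    (fun c f => by
      simp_rw [deriv_smul, norm_mul]
      exact (Real.mul_iSup_of_nonneg (norm_nonneg c) _).symm)

theorem seminorm_apply (n : ℕ) (f : SmoothUnit) :
    seminorm n f = ⨆ τ : Icc (0 : ℝ) 1, ‖f.deriv n τ‖ := rfl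

/-- The topology of `ℰ[0,1]` is generated by the seminorms `δ_n`. -/
instance : TopologicalSpace SmoothUnit :=
  (show SeminormFamily ℂ SmoothUnit ℕ from seminorm).moduleFilterBasis.topology

theorem withSeminorms :
    WithSeminorms (show SeminormFamily ℂ SmoothUnit ℕ from seminorm) := ⟨rfl⟩

/-- Restriction to `[0,1]` of a smooth function on `ℝ`. -/
def restrict (f : ℝ → ℂ) (hf : ContDiff ℝ ∞ f) : SmoothUnit :=
  ⟨fun τ => f τ, hf.contDiffOn.congr fun _ hx => IccExtend_of_mem _ _ hx⟩

theorem deriv_restrict (n : ℕ) (f : ℝ → ℂ) (hf : ContDiff ℝ ∞ f) (τ : Icc (0 : ℝ) 1) :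
    (restrict f hf).deriv n τ = iteratedDeriv n f τ := by
  have h : (n : WithTop ℕ∞) ≤ ∞ := mod_cast le_top
  have h1 : EqOn (restrict f hf).ext f (Icc 0 1) := fun _ hx => IccExtend_of_mem _ _ hx
  exact (iteratedDerivWithin_congr h1 τ.2).trans
    (iteratedDerivWithin_eq_iteratedDeriv uniqueDiffOn_Icc_zero_one (hf.of_le h).contDiffAt τ.2)

/-- Restriction to `[0,1]`, as a linear map from Schwartz functions to `ℰ[0,1]`. -/
def restrictLinear : 𝓢(ℝ, ℂ) →ₗ[ℂ] SmoothUnit where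
  toFun f := restrict f (f.smooth ⊤)
  map_add' _ _ := rfl
  map_smul' _ _ := rfl

theorem continuous_restrictLinear : Continuous restrictLinear := by
  refine WithSeminorms.continuous_of_isBounded (schwartz_withSeminorms ℂ ℝ ℂ) withSeminorms
    restrictLinear fun n => ⟨{(0, n)}, 1, fun f => ?_⟩
  rw [one_smul, Finset.sup_singleton]
  refine ciSup_le fun τ => ?_
  have h : (restrictLinear f).deriv n τ = iteratedDeriv n f τ :=
    deriv_restrict n f (f.smooth ⊤) τ
  have := SchwartzMap.le_seminorm' ℂ 0 n f τ
  rw [h]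
  simpa using this

/-- Restriction to `[0,1]`, as a continuous linear map from Schwartz functions to `ℰ[0,1]`. -/
def restrictSchwartz : 𝓢(ℝ, ℂ) →L[ℂ] SmoothUnit := ⟨restrictLinear, continuous_restrictLinear⟩

end SmoothUnit

/-- The space `ℰ'[0,1]`: continuous linear forms on `ℰ[0,1]`. -/
abbrev UnitDistribution : Type := SmoothUnit →L[ℂ] ℂ

namespace UnitDistribution

open TemperedDistribution

/-- The natural extension of `u ∈ ℰ'[0,1]` to a (compactly supported, hence tempered)
distribution on `ℝ`, namely `f ↦ ⟨u, f|_{[0,1]}⟩`. -/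
def extend (u : UnitDistribution) : 𝓢'(ℝ, ℂ) :=
  ContinuousLinearMap.toPointwiseConvergenceCLM _ _ _ _ (u.comp SmoothUnit.restrictSchwartz)

theorem extend_apply (u : UnitDistribution) (f : 𝓢(ℝ, ℂ)) :
    u.extend f = u (SmoothUnit.restrict f (f.smooth ⊤)) := rfl

/-- `u ∈ H^s_loc(0,1)`: for every `φ ∈ C_c^∞(0,1)` the distribution `φ u` (extended by zero)
belongs to the Sobolev space `H^s(ℝ)`. -/
def MemSobolevLoc (s : ℝ) (u : UnitDistribution) : Prop :=
  ∀ φ : ℝ → ℂ, ContDiff ℝ ∞ φ → HasCompactSupport φ → tsupport φ ⊆ Ioo 0 1 →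
    MemSobolev s 2 (smulLeftCLM ℂ φ u.extend)

end UnitDistribution

/-! ### Convex polygons and spectral functions -/

namespace Polygon

variable {n : ℕ}

/-- `z_1, …, z_n` are, in counterclockwise order, the vertices of a (nondegenerate) convex
polygon in the plane `ℂ`: there are at least three of them, and with respect to every side, which
is directed from `z_i` to `z_{i+1}` (indices modulo `n`), all other vertices lie strictly to the
left. -/
def IsConvexCCW (P : Polygon ℂ n) : Prop :=
  3 ≤ n ∧ ∀ i j : Fin n, j ≠ i → j ≠ finRotate n i →
    0 < (conj (P (finRotate n i) - P i) * (P j - P i)).im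

/-- The length `|Γ_i|` of the side `Γ_i` from `z_i` to `z_{i+1}`. -/
def sideLength (P : Polygon ℂ n) (i : Fin n) : ℝ := ‖P (finRotate n i) - P i‖

/-- The angle `α_i` of the side `Γ_i` with the positive real axis. -/
def sideAngle (P : Polygon ℂ n) (i : Fin n) : ℝ := Complex.arg (P (finRotate n i) - P i)

/-- The parametrisation `ψ_i(τ) = τ z_{i+1} + (1 - τ) z_i` of the side `Γ_i`. -/
def sideParam (P : Polygon ℂ n) (i : Fin n) (τ : ℝ) : ℂ :=
  (τ : ℂ) * P (finRotate n i) + (1 - (τ : ℂ)) * P i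

theorem contDiff_sideParam (P : Polygon ℂ n) (i : Fin n) : ContDiff ℝ ∞ (P.sideParam i) := by
  have : ContDiff ℝ ∞ (fun τ : ℝ => (τ : ℂ)) := Complex.ofRealCLM.contDiff
  unfold sideParam
  fun_prop

/-- The pullback `ψ_i^* f ∈ ℰ[0,1]` of a smooth function `f` on the plane. -/
def pullback (P : Polygon ℂ n) (i : Fin n) (f : ℂ → ℂ) (hf : ContDiff ℝ ∞ f) : SmoothUnit :=
  SmoothUnit.restrict (fun τ => f (P.sideParam i τ)) (hf.comp (P.contDiff_sideParam i))

end Polygon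

/-- The function `z ↦ exp(-iλz + iβ² z̄ / λ)`. -/
def planeExp (β : ℝ) (l : ℂ) (z : ℂ) : ℂ :=
  Complex.exp (-Complex.I * l * z + Complex.I * (β : ℂ) ^ 2 * conj z / l)

theorem contDiff_planeExp (β : ℝ) (l : ℂ) : ContDiff ℝ ∞ (planeExp β l) := by
  have h : ContDiff ℝ ∞ (fun z : ℂ => conj z) := Complex.conjCLE.contDiff
  unfold planeExp
  simp only [div_eq_mul_inv]
  fun_prop

/-- The spectral function of the side `Γ_i` with boundary data `q` (Dirichlet) and `dq` (Neumann):
`ρ_i(λ) = |Γ_i| (⟨dq, ψ_i^* E_λ⟩ + (λ e^{iα_i} + β² / (λ e^{iα_i})) ⟨q, ψ_i^* E_λ⟩)` with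
`E_λ(z) = exp(-iλz + iβ² z̄ / λ)`. It is only used for `λ ≠ 0`. -/
def spectralFunction {n : ℕ} (P : Polygon ℂ n) (β : ℝ) (i : Fin n) (q dq : UnitDistribution)
    (l : ℂ) : ℂ :=
  (P.sideLength i : ℂ) *
    (dq (P.pullback i (planeExp β l) (contDiff_planeExp β l)) +
      (l * Complex.exp (Complex.I * P.sideAngle i) +
          (β : ℂ) ^ 2 / (l * Complex.exp (Complex.I * P.sideAngle i))) *
        q (P.pullback i (planeExp β l) (contDiff_planeExp β l)))

/-- The families `q_i`, `∂_n q_i` in `ℰ'[0,1]` satisfy the global relation: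
`∑_i ρ_i(λ) = 0` for all `λ ∈ ℂ \ {0}`. -/
def GlobalRelation {n : ℕ} (P : Polygon ℂ n) (β : ℝ) (q dq : Fin n → UnitDistribution) : Prop :=
  ∀ l : ℂ, l ≠ 0 → ∑ i, spectralFunction P β i (q i) (dq i) l = 0

end

noncomputable section

/-! Fix the side Γ_i and take coordinates (x, y) with origin z_i, x along Γ_i and y pointing into Ω.
On the ray λe^{iα_i} = k < 0 put X = k - β²/k, which runs through ℝ, and W = √(X² + 4β²). Up to a
factor common to all sides, the exponential becomes exp(-(iXx + Wy)). With X = 2πξ/|Γ_i|, the i-th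
term of the global relation is |Γ_i| times the difference of the Fourier transform of ∂_n q_i and W
times that of q_i. Hence ∂_n q_i is a first-order multiplier applied to q_i plus contributions of
the other sides (`GlobalRelation.exists_fourierFun_eq`).

By convexity every other side lies in a cone y ≥ δ|x - x_p| whose vertex x_p = p|Γ_i|, p ∈ {0, 1},
is an end point of Γ_i. Once exp(-2πipξ) is removed, its contribution extends holomorphically to
discs about ξ of radius comparable to ⟨ξ⟩ and is polynomially bounded there, because the decay in y
beats the growth caused by Im X. Cauchy's estimates then make it a symbol (`exists_isSymbolSeq`). A
symbol times exp(-2πipξ) is the transform of a distribution that is smooth away from p, so a cutoff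
supported in (0,1) puts it in every H^r (`memLp_two_schwartzConv_symbol`). The multiplier W costs
one order, and cutoffs preserve H^{s-1} (`memLp_two_schwartzConv`).

All analysis of ℰ'[0,1] rests on `exists_eq_sum_jet`, which reduces it to bounded functionals on the
Banach space C[0,1]. -/

/-! ### Factorisation of linear forms by Hahn–Banach -/

/-- A linear form that is bounded by the norm of a linear map factors through that map. -/
theorem exists_comp_eq_of_norm_le {V E : Type*} [AddCommGroup V] [Module ℂ V]
    [NormedAddCommGroup E] [NormedSpace ℂ E] (J : V →ₗ[ℂ] E) (u : V →ₗ[ℂ] ℂ) {C : ℝ}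
    (h : ∀ f, ‖u f‖ ≤ C * ‖J f‖) : ∃ W : E →L[ℂ] ℂ, ∀ f, W (J f) = u f := by
  have hker : LinearMap.ker J ≤ LinearMap.ker u := fun f hf => by
    have h2 := h f
    rw [LinearMap.mem_ker.1 hf, norm_zero, mul_zero] at h2
    exact norm_le_zero_iff.1 h2
  let g : LinearMap.range J →ₗ[ℂ] ℂ :=
    (LinearMap.ker J).liftQ u hker ∘ₗ J.quotKerEquivRange.symm.toLinearMap
  have hg (f : V) : g ⟨J f, LinearMap.mem_range_self J f⟩ = u f := by
    change (LinearMap.ker J).liftQ u hker (J.quotKerEquivRange.symm _) = u f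
    rw [LinearMap.quotKerEquivRange_symm_apply_image]
    rfl
  let w : LinearMap.range J →L[ℂ] ℂ := g.mkContinuous C fun x => by
    obtain ⟨x, f, rfl⟩ := x
    rw [hg]
    exact h f
  obtain ⟨W, hW, -⟩ := exists_extension_norm_eq _ w
  exact ⟨W, fun f => (hW ⟨J f, LinearMap.mem_range_self J f⟩).trans (hg f)⟩

/-- A linear form that is bounded by finitely many norms `‖J k f‖` is a sum of bounded forms
in the `J k f`. -/
theorem exists_eq_sum_comp_of_norm_le {V F ι : Type*} [Fintype ι] [DecidableEq ι]
    [AddCommGroup V] [Module ℂ V] [NormedAddCommGroup F] [NormedSpace ℂ F] (J : ι → V →ₗ[ℂ] F)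
    (u : V →ₗ[ℂ] ℂ) {C : ℝ} (h : ∀ f, ‖u f‖ ≤ C * ‖fun k => J k f‖) :
    ∃ v : ι → F →L[ℂ] ℂ, ∀ f, u f = ∑ k, v k (J k f) := by
  obtain ⟨W, hW⟩ := exists_comp_eq_of_norm_le (LinearMap.pi J) u h
  refine ⟨fun k => W.comp (ContinuousLinearMap.single ℂ (fun _ => F) k), fun f => ?_⟩
  change _ = ∑ k, W (Pi.single k (J k f))
  rw [← hW, ← map_sum]
  congr 1
  exact (Finset.univ_sum_single (LinearMap.pi J f)).symm

/-! ### Structure and Laplace transform of distributions in ℰ'[0,1] -/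

namespace SmoothUnit

/-- The `k`-th derivative of a smooth function on `[0,1]`, as a continuous function. -/
def jet (k : ℕ) : SmoothUnit →ₗ[ℂ] C(Icc (0 : ℝ) 1, ℂ) where
  toFun f := ⟨f.deriv k, continuousOn_iff_continuous_domRestrict.1
    (f.contDiffOn_ext.continuousOn_iteratedDerivWithin (m := k) (mod_cast le_top)
      uniqueDiffOn_Icc_zero_one)⟩
  map_add' f g := ContinuousMap.ext fun τ => deriv_add k f g τ
  map_smul' c f := ContinuousMap.ext fun τ => deriv_smul k c f τ

theorem seminorm_eq_norm_jet (k : ℕ) (f : SmoothUnit) : seminorm k f = ‖jet k f‖ := by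
  rw [seminorm_apply, ContinuousMap.norm_eq_iSup_norm]
  rfl

/-- The function `τ ↦ exp(-(A + Bτ))` on `[0,1]`. -/
def expAffine (A B : ℂ) : SmoothUnit :=
  restrict (fun τ : ℝ => Complex.exp (-(A + B * τ)))
    (((contDiff_const.add (contDiff_const.mul Complex.ofRealCLM.contDiff)).neg).cexp)

theorem expAffine_eq_smul (A B : ℂ) : expAffine A B = Complex.exp (-A) • expAffine 0 B := by
  apply Subtype.ext
  funext τ
  change Complex.exp _ = Complex.exp _ * Complex.exp _
  rw [← Complex.exp_add]
  ring_nf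

theorem iteratedDeriv_exp_affine (A B : ℂ) (k : ℕ) (τ : ℝ) :
    iteratedDeriv k (fun τ : ℝ => Complex.exp (-(A + B * τ))) τ
      = (-B) ^ k * Complex.exp (-(A + B * τ)) := by
  induction k generalizing τ with
  | zero => simp
  | succ k ih =>
    rw [iteratedDeriv_succ, funext ih]
    have h1 : HasDerivAt (fun τ : ℝ => -(A + B * τ)) (-(B * 1)) τ :=
      ((Complex.ofRealCLM.hasDerivAt.const_mul B).const_add A).neg
    rw [(h1.cexp.const_mul ((-B) ^ k)).deriv]
    ring

theorem jet_expAffine_apply (A B : ℂ) (k : ℕ) (τ : Icc (0 : ℝ) 1) :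
    jet k (expAffine A B) τ = (-B) ^ k * Complex.exp (-(A + B * (τ : ℝ))) :=
  (deriv_restrict k _ _ τ).trans (iteratedDeriv_exp_affine A B k τ)

/-- Re(A + Bτ) is affine in τ, so it is nonnegative on [0,1] as soon as it is so at both end points;
the exponential then has modulus at most 1. -/
theorem norm_jet_expAffine_le {A B : ℂ} (hA : 0 ≤ A.re) (hB : 0 ≤ (A + B).re) (k : ℕ) :
    ‖jet k (expAffine A B)‖ ≤ ‖B‖ ^ k := by
  rw [ContinuousMap.norm_le _ (by positivity)]
  intro τ
  rw [jet_expAffine_apply, norm_mul, norm_pow, norm_neg, Complex.norm_exp]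
  refine mul_le_of_le_one_right (by positivity) (Real.exp_le_one_iff.2 ?_)
  have h0 := τ.2.1
  have h1 := τ.2.2
  simp only [Complex.neg_re, Complex.add_re, Complex.mul_re, Complex.ofReal_re, Complex.ofReal_im,
    mul_zero, sub_zero] at hB ⊢
  nlinarith [mul_nonneg (sub_nonneg.2 h1) hA, mul_nonneg h0 hB]

/-- The function `τ ↦ -τ` on `[0,1]`. -/
def negCoord : C(Icc (0 : ℝ) 1, ℂ) := ⟨fun τ => -((τ : ℝ) : ℂ), by fun_prop⟩

/-- Writing the jet with the exponential of the Banach algebra C[0,1] makes it holomorphic in B for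
the sup norm, not only pointwise in τ. -/
theorem jet_expAffine_zero (B : ℂ) (k : ℕ) :
    jet k (expAffine 0 B) = (-B) ^ k • NormedSpace.exp (B • negCoord) := by
  ext τ
  rw [jet_expAffine_apply]
  have h := NormedSpace.map_exp (ContinuousMap.evalAlgHom ℂ ℂ τ)
    (continuous_eval_const τ) (B • negCoord)
  change (NormedSpace.exp (B • negCoord)) τ = _ at h
  change _ = (-B) ^ k * (NormedSpace.exp (B • negCoord)) τ
  rw [h, ← Complex.exp_eq_exp_ℂ]
  simp [negCoord]

theorem differentiable_jet_expAffine (k : ℕ) :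
    Differentiable ℂ fun B : ℂ => jet k (expAffine 0 B) := by
  simp_rw [jet_expAffine_zero]
  exact ((differentiable_id.neg).pow k).smul
    fun B => (hasDerivAt_exp_smul_const (𝕂 := ℂ) negCoord B).differentiableAt

end SmoothUnit

namespace UnitDistribution

open SmoothUnit

theorem exists_norm_le_norm_jet (u : UnitDistribution) :
    ∃ (N : ℕ) (C : ℝ), ∀ f, ‖u f‖ ≤ C * ‖fun k : Fin N => jet k f‖ := by
  obtain ⟨s, C, -, h⟩ := Seminorm.bound_of_continuous withSeminorms
    ((normSeminorm ℂ ℂ).comp u.toLinearMap) (continuous_norm.comp u.continuous)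
  -- `Fin N` with N one more than the largest order in `s` covers all orders that occur.
  refine ⟨s.sup id + 1, C, fun f => (h f).trans ?_⟩
  rw [smul_apply, NNReal.smul_def, smul_eq_mul]
  refine mul_le_mul_of_nonneg_left ?_ C.2
  refine Seminorm.finset_sup_apply_le (norm_nonneg _) fun k hk => ?_
  rw [seminorm_eq_norm_jet]
  have hk' : k < s.sup id + 1 := Nat.lt_succ_of_le (Finset.le_sup (f := id) hk)
  exact norm_le_pi_norm (fun k : Fin (s.sup id + 1) => jet k f) ⟨k, hk'⟩

/-- Every `u ∈ ℰ'[0,1]` is a finite sum of derivatives of bounded functionals on `C[0,1]`. -/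
theorem exists_eq_sum_jet (u : UnitDistribution) :
    ∃ (N : ℕ) (v : Fin N → C(Icc (0 : ℝ) 1, ℂ) →L[ℂ] ℂ), ∀ f, u f = ∑ k, v k (jet k f) := by
  obtain ⟨N, C, h⟩ := u.exists_norm_le_norm_jet
  exact ⟨N, exists_eq_sum_comp_of_norm_le (fun k : Fin N => jet k) u.toLinearMap h⟩

/-- The Laplace transform `B ↦ ⟨u, exp(-Bτ)⟩` of `u ∈ ℰ'[0,1]`. -/
def laplace (u : UnitDistribution) (B : ℂ) : ℂ := u (expAffine 0 B)

theorem apply_expAffine (u : UnitDistribution) (A B : ℂ) :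
    u (expAffine A B) = Complex.exp (-A) * u.laplace B := by
  rw [expAffine_eq_smul, map_smul, smul_eq_mul, laplace]

theorem differentiable_laplace (u : UnitDistribution) : Differentiable ℂ u.laplace := by
  obtain ⟨N, v, h⟩ := u.exists_eq_sum_jet
  have : u.laplace = fun B => ∑ k, v k (jet k (expAffine 0 B)) := funext fun B => h _
  rw [this]
  exact Differentiable.fun_sum fun k _ =>
    (v k).differentiable.comp (differentiable_jet_expAffine k)

/-- The factors exp(-A) and `u.laplace B` may each grow exponentially. The bound is therefore stated
for the undivided exponential, with constants independent of A. -/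
theorem exists_norm_apply_expAffine_le (u : UnitDistribution) :
    ∃ (C : ℝ) (N : ℕ), 0 ≤ C ∧ ∀ A B : ℂ, 0 ≤ A.re → 0 ≤ (A + B).re →
      ‖u (expAffine A B)‖ ≤ C * (1 + ‖B‖) ^ N := by
  obtain ⟨N, v, h⟩ := u.exists_eq_sum_jet
  refine ⟨∑ k, ‖v k‖, N, by positivity, fun A B hA hB => ?_⟩
  rw [h, Finset.sum_mul]
  refine (norm_sum_le _ _).trans (Finset.sum_le_sum fun k _ => ?_)
  refine ((v k).le_opNorm _).trans (mul_le_mul_of_nonneg_left ?_ (norm_nonneg _))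
  refine (norm_jet_expAffine_le hA hB k).trans ?_
  calc ‖B‖ ^ (k : ℕ) ≤ (1 + ‖B‖) ^ (k : ℕ) := by gcongr; simp
    _ ≤ (1 + ‖B‖) ^ N := pow_le_pow_right₀ (by simp) k.2.le

open MeasureTheory FourierTransform in
/-- The Fourier transform of the extension of `u` is the function `η ↦ ⟨u, exp(-2πiητ)⟩`. -/
theorem fourier_extend_apply (u : UnitDistribution) (f : 𝓢(ℝ, ℂ)) :
    (𝓕 u.extend) f = ∫ η : ℝ, f η * u.laplace (2 * Real.pi * Complex.I * η) := by
  obtain ⟨N, v, h⟩ := u.exists_eq_sum_jet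
  let c : ℝ → ℂ := fun η => 2 * Real.pi * Complex.I * η
  have hre (η : ℝ) : (c η).re = 0 := by simp [c]
  have hcont (k : ℕ) : Continuous fun η : ℝ => jet k (expAffine 0 (c η)) :=
    (differentiable_jet_expAffine k).continuous.comp (by fun_prop)
  have hint (k : ℕ) : Integrable fun η : ℝ => f η • jet k (expAffine 0 (c η)) := by
    refine ((f.integrable_pow_mul volume k).const_mul ((2 * Real.pi) ^ k)).mono'
      (f.continuous.smul (hcont k)).aestronglyMeasurable (.of_forall fun η => ?_)
    rw [norm_smul]
    refine (mul_le_mul_of_nonneg_left (norm_jet_expAffine_le (by simp) (by simp [hre]) k)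
      (norm_nonneg _)).trans (le_of_eq ?_)
    simp [c, mul_pow, abs_of_pos Real.pi_pos]
    ring
  -- Each jet of 𝓕 f is a Bochner integral in C[0,1], through which the bounded functionals `v k`
  -- can be passed.
  have hJ (k : ℕ) : jet k (restrict (𝓕 f : 𝓢(ℝ, ℂ)) ((𝓕 f : 𝓢(ℝ, ℂ)).smooth ⊤))
      = ∫ η : ℝ, f η • jet k (expAffine 0 (c η)) := by
    ext τ
    rw [← ContinuousMap.evalCLM_apply (R := ℂ) (x := τ)
        (f := ∫ η : ℝ, f η • jet k (expAffine 0 (c η))),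
      ← ContinuousLinearMap.integral_comp_comm _ (hint k)]
    refine (deriv_restrict k _ _ τ).trans ?_
    rw [SchwartzMap.fourier_coe, Real.iteratedDeriv_fourier (N := ⊤) (n := k) _ le_top]
    · rw [Real.fourier_eq']
      congr 1
      funext η
      rw [ContinuousMap.evalCLM_apply, ContinuousMap.smul_apply, jet_expAffine_apply]
      simp only [smul_eq_mul, c, RCLike.inner_apply, conj_trivial, Complex.ofReal_mul,
        Complex.ofReal_neg, Complex.ofReal_ofNat]
      ring_nf
    · intro n _
      refine (f.integrable_pow_mul volume n).mono' (by fun_prop) (.of_forall fun η => ?_)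
      simp
  rw [TemperedDistribution.fourier_apply, extend_apply, h]
  have hu (η : ℝ) : f η * u.laplace (2 * Real.pi * Complex.I * η)
      = ∑ k, v k (f η • jet k (expAffine 0 (c η))) := by
    simp_rw [map_smul, smul_eq_mul, ← Finset.mul_sum, ← h]
    rfl
  simp_rw [hu]
  rw [integral_finsetSum _ fun k _ => (v k).integrable_comp (hint k)]
  refine Finset.sum_congr rfl fun k _ => ?_
  rw [hJ, ContinuousLinearMap.integral_comp_comm _ (hint k)]

end UnitDistribution

/-! ### Weights, slow growth and the Fourier description of H^r -/

open MeasureTheory FourierTransform TemperedDistribution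

/-- The Japanese bracket `⟨ξ⟩ = (1 + ξ²)^{1/2}`. -/
def bracket (ξ : ℝ) : ℝ := √(1 + ξ ^ 2)

theorem one_le_bracket (ξ : ℝ) : 1 ≤ bracket ξ :=
  Real.one_le_sqrt.2 (by nlinarith [sq_nonneg ξ])

theorem bracket_pos (ξ : ℝ) : 0 < bracket ξ := zero_lt_one.trans_le (one_le_bracket ξ)

theorem bracket_sq (ξ : ℝ) : bracket ξ ^ 2 = 1 + ξ ^ 2 := Real.sq_sqrt (by positivity)

theorem bracket_neg (ξ : ℝ) : bracket (-ξ) = bracket ξ := by simp [bracket]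

theorem abs_le_bracket (ξ : ℝ) : |ξ| ≤ bracket ξ :=
  Real.abs_le_sqrt (by linarith)

theorem continuous_bracket : Continuous bracket := by unfold bracket; fun_prop

theorem one_add_norm_sq_rpow_eq (r ξ : ℝ) : (1 + ‖ξ‖ ^ 2) ^ (r / 2) = bracket ξ ^ r := by
  rw [bracket, Real.sqrt_eq_rpow, ← Real.rpow_mul (by positivity), Real.norm_eq_abs, sq_abs]
  congr 1
  ring

theorem continuous_bracket_rpow (r : ℝ) : Continuous fun ξ => bracket ξ ^ r :=
  continuous_bracket.rpow_const fun ξ => Or.inl (bracket_pos ξ).ne'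

theorem hasTemperateGrowth_bracket_rpow (r : ℝ) :
    Function.HasTemperateGrowth fun ξ : ℝ => ((bracket ξ ^ r : ℝ) : ℂ) := by
  simp_rw [← one_add_norm_sq_rpow_eq]
  fun_prop

theorem bracket_le_two_mul (ξ η : ℝ) : bracket ξ ≤ 2 * (bracket (ξ - η) * bracket η) := by
  refine Real.sqrt_le_left (by have := bracket_pos (ξ - η); have := bracket_pos η; positivity) |>.2 ?_
  rw [mul_pow, mul_pow, bracket_sq, bracket_sq]
  nlinarith [sq_nonneg (ξ - 2 * η), sq_nonneg ((ξ - η) * η), sq_nonneg η, sq_nonneg (ξ - η)]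

/-- Peetre's inequality. -/
theorem bracket_rpow_le (r ξ η : ℝ) :
    bracket ξ ^ r ≤ 2 ^ |r| * bracket (ξ - η) ^ |r| * bracket η ^ r := by
  have h1 := bracket_pos ξ
  have h2 := bracket_pos η
  have h3 := bracket_pos (ξ - η)
  rcases le_total 0 r with hr | hr
  · rw [abs_of_nonneg hr, ← Real.mul_rpow (by positivity) (by positivity),
      ← Real.mul_rpow (by positivity) (by positivity)]
    refine Real.rpow_le_rpow h1.le ?_ hr
    rw [mul_assoc]
    exact bracket_le_two_mul ξ η
  · rw [abs_of_nonpos hr]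
    -- For r ≤ 0 this is the case of the exponent -r with ξ and η interchanged.
    have h : bracket η ^ (-r) ≤ 2 ^ (-r) * bracket (ξ - η) ^ (-r) * bracket ξ ^ (-r) := by
      rw [← Real.mul_rpow (by positivity) (by positivity),
        ← Real.mul_rpow (by positivity) (by positivity)]
      refine Real.rpow_le_rpow h2.le ?_ (by linarith)
      have := bracket_le_two_mul η ξ
      rwa [← neg_sub, bracket_neg, ← mul_assoc] at this
    calc bracket ξ ^ r = bracket η ^ (-r) * (bracket ξ ^ r * bracket η ^ r) := by
          rw [Real.rpow_neg h2.le]; field_simp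
      _ ≤ (2 ^ (-r) * bracket (ξ - η) ^ (-r) * bracket ξ ^ (-r)) *
            (bracket ξ ^ r * bracket η ^ r) := by gcongr
      _ = _ := by rw [Real.rpow_neg h1.le]; field_simp

/-- Continuous functions of at most polynomial growth. -/
structure HasSlowGrowth (g : ℝ → ℂ) : Prop where
  continuous : Continuous g
  bound : ∃ C M : ℝ, ∀ η, ‖g η‖ ≤ C * bracket η ^ M

namespace HasSlowGrowth

variable {g h : ℝ → ℂ}

theorem integrable_mul (hg : HasSlowGrowth g) (f : 𝓢(ℝ, ℂ)) :
    Integrable fun η => f η * g η := by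
  obtain ⟨C, M, hC⟩ := hg.bound
  refine ((SchwartzMap.smulLeftCLM ℂ (fun ξ : ℝ => ((bracket ξ ^ M : ℝ) : ℂ)) f).integrable.norm
    |>.const_mul C).mono' (f.continuous.mul hg.continuous).aestronglyMeasurable
    (.of_forall fun η => ?_)
  rw [SchwartzMap.smulLeftCLM_apply_apply (hasTemperateGrowth_bracket_rpow M), norm_mul,
    norm_smul, Complex.norm_real, Real.norm_of_nonneg (Real.rpow_nonneg (bracket_pos η).le M)]
  calc ‖f η‖ * ‖g η‖ ≤ ‖f η‖ * (C * bracket η ^ M) := by gcongr; exact hC η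
    _ = _ := by ring

theorem comp_sub (hg : HasSlowGrowth g) (ξ : ℝ) : HasSlowGrowth fun η => g (ξ - η) := by
  refine ⟨hg.continuous.comp (by fun_prop), ?_⟩
  obtain ⟨C, M, hC⟩ := hg.bound
  have hC0 : 0 ≤ C := by
    have := (norm_nonneg _).trans (hC 0)
    exact nonneg_of_mul_nonneg_left this (Real.rpow_pos_of_pos (bracket_pos 0) M)
  refine ⟨C * (2 ^ |M| * bracket ξ ^ M), |M|, fun η => (hC _).trans ?_⟩
  have h := bracket_rpow_le M (ξ - η) ξ
  rw [sub_sub_cancel_left, bracket_neg] at h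
  calc _ ≤ C * (2 ^ |M| * bracket η ^ |M| * bracket ξ ^ M) := by gcongr
    _ = _ := by ring

theorem integrable_sub_mul (hg : HasSlowGrowth g) (f : 𝓢(ℝ, ℂ)) (ξ : ℝ) :
    Integrable fun η => f (ξ - η) * g η := by
  simpa using ((hg.comp_sub ξ).integrable_mul f).comp_sub_left ξ

theorem mul (hg : HasSlowGrowth g) (hh : HasSlowGrowth h) :
    HasSlowGrowth fun η => g η * h η := by
  refine ⟨hg.continuous.mul hh.continuous, ?_⟩
  obtain ⟨C, M, hC⟩ := hg.bound
  obtain ⟨C', M', hC'⟩ := hh.bound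
  refine ⟨C * C', M + M', fun η => ?_⟩
  rw [norm_mul, Real.rpow_add (bracket_pos η), mul_mul_mul_comm]
  exact mul_le_mul (hC η) (hC' η) (norm_nonneg _) ((norm_nonneg _).trans (hC η))

end HasSlowGrowth

/-- The product is dominated by a multiple of ⟨η⟩⁻¹, whose square 1/(1 + η²) is integrable. -/
theorem memLp_two_bracket_rpow_mul {g : ℝ → ℂ} (hg : Continuous g) {C M r : ℝ}
    (h : ∀ η, ‖g η‖ ≤ C * bracket η ^ M) (hr : r + M ≤ -1) :
    MemLp (fun η => ((bracket η ^ r : ℝ) : ℂ) * g η) 2 := by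
  have hc : Continuous fun η => ((bracket η ^ r : ℝ) : ℂ) * g η :=
    (Complex.continuous_ofReal.comp (continuous_bracket_rpow r)).mul hg
  have h1 : MemLp (fun η => C * bracket η ^ (-1 : ℝ)) 2 := by
    rw [memLp_two_iff_integrable_sq ((continuous_bracket_rpow _).const_mul C).aestronglyMeasurable]
    refine (integrable_inv_one_add_sq.const_mul (C ^ 2)).congr (.of_forall fun η => ?_)
    simp only [mul_pow, Real.rpow_neg_one, inv_pow, bracket_sq]
  refine h1.mono hc.aestronglyMeasurable (.of_forall fun η => ?_)
  have hb := bracket_pos η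
  have hC : 0 ≤ C := by
    have := (norm_nonneg _).trans (h η)
    exact nonneg_of_mul_nonneg_left this (Real.rpow_pos_of_pos hb M)
  rw [norm_mul, Complex.norm_real, Real.norm_of_nonneg (by positivity),
    Real.norm_of_nonneg (by positivity)]
  calc bracket η ^ r * ‖g η‖ ≤ bracket η ^ r * (C * bracket η ^ M) := by gcongr; exact h η
    _ = C * bracket η ^ (r + M) := by rw [Real.rpow_add hb]; ring
    _ ≤ _ := by
      gcongr
      exact one_le_bracket η

/-- For a tempered distribution whose Fourier transform is a function `g`, membership in `H^r` is
square integrability of `⟨ξ⟩^r g`. -/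
theorem memSobolev_two_iff_memLp {T : 𝓢'(ℝ, ℂ)} {g : ℝ → ℂ} (hg : HasSlowGrowth g)
    (hT : ∀ f : 𝓢(ℝ, ℂ), (𝓕 T) f = ∫ η, f η * g η) (r : ℝ) :
    MemSobolev r 2 T ↔ MemLp (fun η => ((bracket η ^ r : ℝ) : ℂ) * g η) 2 := by
  have hw := hasTemperateGrowth_bracket_rpow r
  have hsm (f : 𝓢(ℝ, ℂ)) :
      smulLeftCLM ℂ (fun x : ℝ ↦ (((1 + ‖x‖ ^ 2) ^ (r / 2) : ℝ) : ℂ)) (𝓕 T) f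
        = ∫ η, f η * (((bracket η ^ r : ℝ) : ℂ) * g η) := by
    simp_rw [one_add_norm_sq_rpow_eq]
    rw [smulLeftCLM_apply_apply, hT]
    congr 1
    funext η
    rw [SchwartzMap.smulLeftCLM_apply_apply hw, smul_eq_mul]
    ring
  rw [memSobolev_iff_exists_smulLeftCLM_fourier]
  constructor
  · rintro ⟨f', hf'⟩
    refine (Lp.memLp f').ae_eq ?_
    have hc : Continuous fun η => ((bracket η ^ r : ℝ) : ℂ) * g η :=
      hw.1.continuous.mul hg.continuous
    -- Both functions are locally integrable and have equal pairings with test functions, hence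
    -- agree almost everywhere.
    refine (ae_eq_of_integral_contDiff_smul_eq hc.locallyIntegrable
      ((Lp.memLp f').locallyIntegrable one_le_two) fun φ hφ hφc => ?_).mono fun _ h => h.symm
    have hφ' : ContDiff ℝ ∞ fun x => (φ x : ℂ) := Complex.ofRealCLM.contDiff.comp hφ
    have hφc' : HasCompactSupport fun x => (φ x : ℂ) := hφc.comp_left Complex.ofReal_zero
    have h1 := hsm (hφc'.toSchwartzMap hφ')
    rw [hf', Lp.toTemperedDistribution_apply] at h1
    simpa using h1.symm
  · intro h
    refine ⟨h.toLp, ?_⟩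
    ext f
    rw [hsm, Lp.toTemperedDistribution_apply]
    refine integral_congr_ae ?_
    filter_upwards [h.coeFn_toLp] with η hη
    rw [hη, smul_eq_mul]

/-! ### Convolution in weighted L² -/

/-- The convolution of a Schwartz function with a function. -/
def schwartzConv (f : 𝓢(ℝ, ℂ)) (g : ℝ → ℂ) (ξ : ℝ) : ℂ := ∫ η, f (ξ - η) * g η

theorem stronglyMeasurable_schwartzConv (f : 𝓢(ℝ, ℂ)) {g : ℝ → ℂ} (hg : Continuous g) :
    StronglyMeasurable (schwartzConv f g) := by
  have : Continuous fun z : ℝ × ℝ => f (z.1 - z.2) * g z.2 := by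
    have := f.continuous
    fun_prop
  exact this.stronglyMeasurable.integral_prod_right'

open ENNReal in
-- Young's inequality L¹ * L² ⊆ L²: split k = k^{1/2} k^{1/2}, apply Cauchy–Schwarz to the inner
-- integral, then Tonelli and translation invariance.
theorem lintegral_conv_sq_le {k h : ℝ → ℝ≥0∞} (hk : Measurable k) (hh : Measurable h) :
    ∫⁻ ξ : ℝ, (∫⁻ η, k (ξ - η) * h η) ^ 2 ≤ (∫⁻ ξ, k ξ) ^ 2 * ∫⁻ η, h η ^ 2 := by
  have hsq (a : ℝ≥0∞) : (a ^ (1 / 2 : ℝ)) ^ 2 = a := by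
    rw [← ENNReal.rpow_natCast, ← ENNReal.rpow_mul]; norm_num
  have hk' (ξ : ℝ) : Measurable fun η => k (ξ - η) := hk.comp (by fun_prop)
  have h1 (ξ : ℝ) : (∫⁻ η, k (ξ - η) * h η) ^ 2
      ≤ (∫⁻ η, k η) * ∫⁻ η, k (ξ - η) * h η ^ 2 := by
    have h2 := lintegral_mul_le_Lp_mul_Lq volume Real.HolderConjugate.two_two
      (f := fun η => k (ξ - η) ^ (1 / 2 : ℝ)) (g := fun η => k (ξ - η) ^ (1 / 2 : ℝ) * h η)
      ((hk' ξ).pow_const _).aemeasurable (((hk' ξ).pow_const _).mul hh).aemeasurable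
    simp only [Pi.mul_apply, ENNReal.rpow_two, mul_pow, hsq, ← mul_assoc, ← sq] at h2
    calc _ ≤ _ := pow_le_pow_left' h2 2
      _ = _ := by rw [mul_pow, hsq, hsq, lintegral_sub_left_eq_self k ξ]
  calc _ ≤ ∫⁻ ξ : ℝ, (∫⁻ η, k η) * ∫⁻ η, k (ξ - η) * h η ^ 2 := lintegral_mono h1
    _ = (∫⁻ η, k η) * ∫⁻ ξ : ℝ, ∫⁻ η, k (ξ - η) * h η ^ 2 :=
      by
      refine lintegral_const_mul _ (Measurable.lintegral_prod_right'
        (f := fun z : ℝ × ℝ => k (z.1 - z.2) * h z.2 ^ 2) ?_)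
      fun_prop
    _ = (∫⁻ η, k η) * ∫⁻ η, ∫⁻ ξ : ℝ, k (ξ - η) * h η ^ 2 := by
      rw [lintegral_lintegral_swap (by fun_prop)]
    _ = _ := by
      have (η : ℝ) : ∫⁻ ξ : ℝ, k (ξ - η) * h η ^ 2 = (∫⁻ ξ, k ξ) * h η ^ 2 := by
        rw [lintegral_mul_const _ (by fun_prop), lintegral_sub_right_eq_self k η]
      simp_rw [this]
      rw [lintegral_const_mul _ (by fun_prop), ← mul_assoc, sq]

/-- Convolution with a Schwartz function preserves weighted `L²` spaces. -/
theorem memLp_two_schwartzConv (f : 𝓢(ℝ, ℂ)) {g : ℝ → ℂ} (hg : Continuous g) {r : ℝ}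
    (h : MemLp (fun η => ((bracket η ^ r : ℝ) : ℂ) * g η) 2) :
    MemLp (fun ξ => ((bracket ξ ^ r : ℝ) : ℂ) * schwartzConv f g ξ) 2 := by
  have hw := hasTemperateGrowth_bracket_rpow |r|
  -- Peetre's inequality moves the weight inside the convolution. `F` collects its constant and the
  -- factor ⟨ξ - η⟩^{|r|}; it is still Schwartz, hence in L¹.
  set F := (((2 : ℝ) ^ |r| : ℝ) : ℂ) • SchwartzMap.smulLeftCLM ℂ (fun ξ : ℝ => ((bracket ξ ^ |r| : ℝ) : ℂ)) f with hF
  set G : ℝ → ℂ := fun η => ((bracket η ^ r : ℝ) : ℂ) * g η with hG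
  have hGc : Continuous G := (hasTemperateGrowth_bracket_rpow r).1.continuous.mul hg
  have hmeas : AEStronglyMeasurable (fun ξ => ((bracket ξ ^ r : ℝ) : ℂ) * schwartzConv f g ξ) :=
    ((hasTemperateGrowth_bracket_rpow r).1.continuous.stronglyMeasurable.mul
      (stronglyMeasurable_schwartzConv f hg)).aestronglyMeasurable
  have key (ξ : ℝ) : ‖((bracket ξ ^ r : ℝ) : ℂ) * schwartzConv f g ξ‖ₑ
      ≤ ∫⁻ η, ‖F (ξ - η)‖ₑ * ‖G η‖ₑ := by
    rw [schwartzConv, ← integral_const_mul]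
    refine (enorm_integral_le_lintegral_enorm _).trans (lintegral_mono fun η => ?_)
    rw [← enorm_mul, enorm_le_iff_norm_le]
    have h1 := bracket_pos ξ
    have h2 := bracket_pos η
    have h3 := bracket_pos (ξ - η)
    simp only [hF, hG, smul_apply, SchwartzMap.smulLeftCLM_apply_apply hw, smul_eq_mul,
      norm_mul, Complex.norm_real]
    rw [Real.norm_of_nonneg (by positivity), Real.norm_of_nonneg (by positivity),
      Real.norm_of_nonneg (by positivity), Real.norm_of_nonneg (by positivity)]
    calc bracket ξ ^ r * (‖f (ξ - η)‖ * ‖g η‖)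
        ≤ (2 ^ |r| * bracket (ξ - η) ^ |r| * bracket η ^ r) * (‖f (ξ - η)‖ * ‖g η‖) := by
          gcongr
          exact bracket_rpow_le r ξ η
      _ = _ := by ring
  rw [MemLp, eLpNorm_lt_top_iff_lintegral_rpow_enorm_lt_top (by norm_num) (by norm_num)]
  have hG2 := h.2
  rw [eLpNorm_lt_top_iff_lintegral_rpow_enorm_lt_top (by norm_num) (by norm_num)] at hG2
  simp only [ENNReal.toReal_ofNat, ENNReal.rpow_two] at hG2 ⊢
  refine ⟨hmeas, (lintegral_mono fun ξ => pow_le_pow_left' (key ξ) 2).trans_lt ?_⟩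
  exact (lintegral_conv_sq_le F.continuous.enorm.measurable hGc.enorm.measurable).trans_lt
    (ENNReal.mul_lt_top (ENNReal.pow_lt_top F.integrable.2) hG2)

/-! ### Smoothness away from the point p -/

/-- The character `η ↦ exp(-2πipη)`. -/
def expChar (p η : ℝ) : ℂ := Complex.exp (-2 * Real.pi * Complex.I * p * η)

theorem hasDerivAt_expChar (p η : ℝ) :
    HasDerivAt (expChar p) (-2 * Real.pi * Complex.I * p * expChar p η) η := by
  have h : HasDerivAt (fun η : ℝ => -2 * Real.pi * Complex.I * p * (η : ℂ))
      (-2 * Real.pi * Complex.I * p * 1) η := Complex.ofRealCLM.hasDerivAt.const_mul _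
  have h2 := h.cexp
  rw [mul_one, mul_comm (Complex.exp _)] at h2
  exact h2

theorem norm_expChar (p η : ℝ) : ‖expChar p η‖ = 1 := by
  rw [expChar, Complex.norm_exp]
  simp

theorem hasSlowGrowth_expChar (p : ℝ) : HasSlowGrowth (expChar p) :=
  ⟨by unfold expChar; fun_prop, 1, 0, fun η => by simp [norm_expChar]⟩

theorem hasDerivAt_fourier_schwartz (ψ : 𝓢(ℝ, ℂ)) (ζ : ℝ) :
    HasDerivAt (𝓕 ψ : 𝓢(ℝ, ℂ)) (-2 * Real.pi * Complex.I *
      (𝓕 (SchwartzMap.smulLeftCLM ℂ Complex.ofReal ψ) : 𝓢(ℝ, ℂ)) ζ) ζ := by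
  have hx : Integrable fun x : ℝ => x • ψ x := by
    refine ((ψ.integrable_pow_mul volume 1)).mono' (by fun_prop) (.of_forall fun x => ?_)
    simp
  have h := Real.hasDerivAt_fourier ψ.integrable hx ζ
  rw [SchwartzMap.fourier_coe, SchwartzMap.fourier_coe]
  refine h.congr_deriv ?_
  rw [Real.fourier_eq, Real.fourier_eq, ← integral_const_mul]
  congr 1
  funext v
  rw [SchwartzMap.smulLeftCLM_apply_apply (by fun_prop)]
  simp only [smul_eq_mul, Circle.smul_def]
  ring

/-- Multiplication by `t - p` on the physical side is a derivative on the Fourier side. -/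
theorem schwartzConv_fourier_sub_mul {p : ℝ} {ψ ψ₁ : 𝓢(ℝ, ℂ)}
    (hψ : ∀ t : ℝ, ψ₁ t = ((t : ℂ) - p) * ψ t) {S S' : ℝ → ℂ} (hS : HasSlowGrowth S)
    (hS' : HasSlowGrowth S') (hd : ∀ η, HasDerivAt S (S' η) η) (ξ : ℝ) :
    schwartzConv (𝓕 ψ₁) (fun η => expChar p η * S η) ξ =
      (-2 * Real.pi * Complex.I)⁻¹ * schwartzConv (𝓕 ψ) (fun η => expChar p η * S' η) ξ := by
  set χ := SchwartzMap.smulLeftCLM ℂ Complex.ofReal ψ with hχ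
  have h1 : ψ₁ = χ - (p : ℂ) • ψ := by
    ext t
    rw [hψ, sub_apply, hχ, SchwartzMap.smulLeftCLM_apply_apply (by fun_prop)]
    simp [sub_mul]
  have hne : (-2 * Real.pi * Complex.I : ℂ) ≠ 0 := by
    simp [Real.pi_ne_zero]
  have hG := (hasSlowGrowth_expChar p).mul hS
  have hG' := (hasSlowGrowth_expChar p).mul hS'
  have hu (η : ℝ) : HasDerivAt (fun η => (𝓕 ψ : 𝓢(ℝ, ℂ)) (ξ - η))
      (-(-2 * Real.pi * Complex.I * (𝓕 χ : 𝓢(ℝ, ℂ)) (ξ - η))) η :=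
    (hasDerivAt_fourier_schwartz ψ (ξ - η)).comp_const_sub ξ η
  have hv (η : ℝ) : HasDerivAt (fun η => expChar p η * S η)
      (-2 * Real.pi * Complex.I * p * expChar p η * S η + expChar p η * S' η) η :=
    (hasDerivAt_expChar p η).mul (hd η)
  have i0 := hG.integrable_sub_mul (𝓕 ψ) ξ
  have i1 := hG'.integrable_sub_mul (𝓕 ψ) ξ
  have i2 := hG.integrable_sub_mul (𝓕 χ) ξ
  -- Integration by parts in η. The derivative of `expChar p` contributes the term with p, which
  -- turns multiplication by t into multiplication by t - p.
  have ibp := integral_mul_deriv_eq_deriv_mul_of_integrable (fun η _ => hu η) (fun η _ => hv η)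
    (((i0.const_mul (-2 * Real.pi * Complex.I * p)).add i1).congr (.of_forall fun η => by
      simp only [Pi.add_apply, Pi.mul_apply]; ring))
    ((i2.const_mul (-(-2 * Real.pi * Complex.I))).congr (.of_forall fun η => by
      simp only [Pi.mul_apply]; ring)) i0
  have e1 : ∫ η, (𝓕 ψ : 𝓢(ℝ, ℂ)) (ξ - η) *
      (-2 * Real.pi * Complex.I * p * expChar p η * S η + expChar p η * S' η)
      = -2 * Real.pi * Complex.I * p * schwartzConv (𝓕 ψ) (fun η => expChar p η * S η) ξ
        + schwartzConv (𝓕 ψ) (fun η => expChar p η * S' η) ξ := by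
    rw [schwartzConv, schwartzConv, ← integral_const_mul,
      ← integral_add (i0.const_mul _) i1]
    congr 1
    funext η
    ring
  have e2 : ∫ η, -(-2 * Real.pi * Complex.I * (𝓕 χ : 𝓢(ℝ, ℂ)) (ξ - η)) * (expChar p η * S η)
      = 2 * Real.pi * Complex.I * schwartzConv (𝓕 χ) (fun η => expChar p η * S η) ξ := by
    rw [schwartzConv, ← integral_const_mul]
    congr 1
    funext η
    ring
  have e3 : schwartzConv (𝓕 ψ₁) (fun η => expChar p η * S η) ξ
      = schwartzConv (𝓕 χ) (fun η => expChar p η * S η) ξ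
        - p * schwartzConv (𝓕 ψ) (fun η => expChar p η * S η) ξ := by
    rw [schwartzConv, schwartzConv, schwartzConv, ← integral_const_mul,
      ← integral_sub i2 (i0.const_mul _), h1, sub_eq_add_neg, ← neg_smul,
      FourierTransform.fourier_add, FourierTransform.fourier_smul]
    congr 1
    funext η
    simp only [add_apply, smul_apply, smul_eq_mul]
    ring
  rw [e1, e2] at ibp
  rw [e3, eq_inv_mul_iff_mul_eq₀ hne]
  linear_combination -ibp

/-- If `p` is not in the support of `φ`, then convolution with the Fourier transform of `φ` turns
`exp(-2πipη)` times a symbol into a rapidly decreasing function. -/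
theorem memLp_two_schwartzConv_symbol {p : ℝ} {φ : ℝ → ℂ} (hφ : ContDiff ℝ ∞ φ)
    (hφc : HasCompactSupport φ) (hp : p ∉ tsupport φ) {S : ℕ → ℝ → ℂ} {M : ℝ}
    (hd : ∀ n η, HasDerivAt (S n) (S (n + 1) η) η)
    (hS : ∀ n : ℕ, ∃ C : ℝ, ∀ η, ‖S n η‖ ≤ C * bracket η ^ (M - n)) (r : ℝ) :
    MemLp (fun ξ => ((bracket ξ ^ r : ℝ) : ℂ) *
      schwartzConv (𝓕 (hφc.toSchwartzMap hφ)) (fun η => expChar p η * S 0 η) ξ) 2 := by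
  have hcont (n : ℕ) : Continuous (S n) :=
    continuous_iff_continuousAt.2 fun η => (hd n η).continuousAt
  have hslow (n : ℕ) : HasSlowGrowth (S n) := ⟨hcont n, (hS n).choose, _, (hS n).choose_spec⟩
  -- Each step divides the cutoff by t - p, which is harmless since p is off its support, and trades
  -- this for one more derivative of the symbol.
  have step (n : ℕ) : ∃ (ψ : ℝ → ℂ) (hψ : ContDiff ℝ ∞ ψ) (hψc : HasCompactSupport ψ) (c : ℂ),
      p ∉ tsupport ψ ∧ ∀ ξ,
      schwartzConv (𝓕 (hφc.toSchwartzMap hφ)) (fun η => expChar p η * S 0 η) ξ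
        = c * schwartzConv (𝓕 (hψc.toSchwartzMap hψ)) (fun η => expChar p η * S n η) ξ := by
    induction n with
    | zero => exact ⟨φ, hφ, hφc, 1, hp, fun ξ => (one_mul _).symm⟩
    | succ n ih =>
      obtain ⟨ψ, hψ, hψc, c, hpψ, h⟩ := ih
      have hsub : tsupport (fun t : ℝ => ((t : ℂ) - p)⁻¹ * ψ t) ⊆ tsupport ψ :=
        tsupport_mul_subset_right
      have hsm : ContDiff ℝ ∞ fun t : ℝ => ((t : ℂ) - p)⁻¹ * ψ t := by
        rw [contDiff_iff_contDiffAt]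
        intro t
        by_cases ht : t ∈ tsupport ψ
        · have hne : (t : ℂ) - p ≠ 0 := by
            rw [← Complex.ofReal_sub, Complex.ofReal_ne_zero, sub_ne_zero]
            rintro rfl
            exact hpψ ht
          exact ((Complex.ofRealCLM.contDiff.contDiffAt.sub contDiffAt_const).inv hne).mul
            hψ.contDiffAt
        · have : (fun t : ℝ => ((t : ℂ) - p)⁻¹ * ψ t) =ᶠ[nhds t] fun _ => 0 := by
            filter_upwards [(isClosed_tsupport ψ).isOpen_compl.mem_nhds ht] with x hx
            rw [image_eq_zero_of_notMem_tsupport hx, mul_zero]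
          exact contDiffAt_const.congr_of_eventuallyEq this
      refine ⟨_, hsm, hψc.mul_left, c * (-2 * Real.pi * Complex.I)⁻¹,
        fun hx => hpψ (hsub hx), fun ξ => ?_⟩
      rw [h, schwartzConv_fourier_sub_mul (ψ := (hψc.mul_left).toSchwartzMap hsm) (fun t => ?_)
        (hslow n) (hslow (n + 1)) (hd n)]
      · ring
      · change ψ t = ((t : ℂ) - p) * (((t : ℂ) - p)⁻¹ * ψ t)
        by_cases ht : t ∈ tsupport ψ
        · have hne : (t : ℂ) - p ≠ 0 := by
            rw [← Complex.ofReal_sub, Complex.ofReal_ne_zero, sub_ne_zero]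
            rintro rfl
            exact hpψ ht
          rw [mul_inv_cancel_left₀ hne]
        · rw [image_eq_zero_of_notMem_tsupport ht, mul_zero, mul_zero]
  -- This n makes r + (M - n) ≤ -1, the threshold for square integrability.
  obtain ⟨n, hn⟩ := exists_nat_ge (r + M + 1)
  obtain ⟨ψ, hψ, hψc, c, -, h⟩ := step n
  obtain ⟨C, hC⟩ := hS n
  have hc : Continuous fun η => expChar p η * S n η :=
    (hasSlowGrowth_expChar p).continuous.mul (hcont n)
  have h1 : MemLp (fun η => ((bracket η ^ r : ℝ) : ℂ) * (expChar p η * S n η)) 2 :=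
    memLp_two_bracket_rpow_mul hc (C := C) (M := M - n)
      (fun η => by rw [norm_mul, norm_expChar, one_mul]; exact hC η) (by linarith)
  refine ((memLp_two_schwartzConv (𝓕 (hψc.toSchwartzMap hψ)) hc h1).const_mul c).ae_eq
    (.of_forall fun ξ => ?_)
  simp only [h]
  ring

/-! ### Cutoffs on ℰ'[0,1] and local Sobolev regularity -/

namespace SmoothUnit

theorem norm_deriv_le_seminorm (n : ℕ) (f : SmoothUnit) (τ : Icc (0 : ℝ) 1) :
    ‖f.deriv n τ‖ ≤ seminorm n f := le_ciSup (f.bddAbove_deriv n) τ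

/-- Multiplication by a smooth function, as a linear map of `ℰ[0,1]`. -/
def mulLinear (φ : ℝ → ℂ) (hφ : ContDiff ℝ ∞ φ) : SmoothUnit →ₗ[ℂ] SmoothUnit where
  toFun f := ⟨fun τ => φ τ * f.1 τ, (hφ.contDiffOn.mul f.contDiffOn_ext).congr fun x hx => by
    rw [IccExtend_of_mem _ _ hx]
    simp only [ext, IccExtend_of_mem _ _ hx]⟩
  map_add' f g := Subtype.ext (funext fun τ => mul_add (φ τ) (f.1 τ) (g.1 τ))
  map_smul' c f := Subtype.ext (funext fun τ => mul_left_comm (φ τ) c (f.1 τ))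

theorem deriv_mulLinear (φ : ℝ → ℂ) (hφ : ContDiff ℝ ∞ φ) (n : ℕ) (f : SmoothUnit)
    (τ : Icc (0 : ℝ) 1) : (mulLinear φ hφ f).deriv n τ = ∑ i ∈ Finset.range (n + 1),
      n.choose i * (restrict φ hφ).deriv i τ * f.deriv (n - i) τ := by
  have h1 : EqOn (mulLinear φ hφ f).ext ((restrict φ hφ).ext * f.ext) (Icc 0 1) := fun x hx => by
    simp only [ext, Pi.mul_apply, IccExtend_of_mem _ _ hx]
    rfl
  have hn : (n : WithTop ℕ∞) ≤ ∞ := mod_cast le_top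
  refine (iteratedDerivWithin_congr h1 τ.2).trans ?_
  exact iteratedDerivWithin_mul τ.2 uniqueDiffOn_Icc_zero_one
    (((restrict φ hφ).contDiffOn_ext.of_le hn) τ τ.2) ((f.contDiffOn_ext.of_le hn) τ τ.2)

theorem continuous_mulLinear (φ : ℝ → ℂ) (hφ : ContDiff ℝ ∞ φ) :
    Continuous (mulLinear φ hφ) := by
  refine WithSeminorms.continuous_of_isBounded withSeminorms withSeminorms _ fun n => ?_
  let p : SeminormFamily ℂ SmoothUnit ℕ := seminorm
  have hC : 0 ≤ ∑ i ∈ Finset.range (n + 1), (n.choose i : ℝ) * seminorm i (restrict φ hφ) :=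
    Finset.sum_nonneg fun i _ => mul_nonneg (Nat.cast_nonneg _) (apply_nonneg _ _)
  refine ⟨Finset.range (n + 1), ⟨_, hC⟩, fun f => ciSup_le fun τ => ?_⟩
  change _ ≤ (∑ i ∈ Finset.range (n + 1), (n.choose i : ℝ) * seminorm i (restrict φ hφ)) *
    (Finset.range (n + 1)).sup p f
  rw [deriv_mulLinear, Finset.sum_mul]
  refine (norm_sum_le _ _).trans (Finset.sum_le_sum fun i hi => ?_)
  rw [norm_mul, norm_mul, Complex.norm_natCast]
  have h1 : ‖f.deriv (n - i) τ‖ ≤ (Finset.range (n + 1)).sup p f :=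
    (norm_deriv_le_seminorm _ f τ).trans
      (Seminorm.le_finset_sup_apply (p := p) (Finset.mem_range.2 (by omega : n - i < n + 1)))
  gcongr
  exact norm_deriv_le_seminorm _ _ _

/-- Multiplication by a smooth function on `ℰ[0,1]`. -/
def mulSmooth (φ : ℝ → ℂ) (hφ : ContDiff ℝ ∞ φ) : SmoothUnit →L[ℂ] SmoothUnit :=
  ⟨mulLinear φ hφ, continuous_mulLinear φ hφ⟩

end SmoothUnit

namespace UnitDistribution

open SmoothUnit

/-- The Fourier transform `η ↦ ⟨u, exp(-2πiητ)⟩` of `u ∈ ℰ'[0,1]`. -/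
def fourierFun (u : UnitDistribution) (η : ℝ) : ℂ := u.laplace (2 * Real.pi * Complex.I * η)

theorem hasSlowGrowth_fourierFun (u : UnitDistribution) : HasSlowGrowth u.fourierFun := by
  refine ⟨u.differentiable_laplace.continuous.comp (by fun_prop), ?_⟩
  obtain ⟨C, N, hC, h⟩ := u.exists_norm_apply_expAffine_le
  refine ⟨C * (1 + 2 * Real.pi) ^ N, N, fun η => ?_⟩
  have h1 := h 0 (2 * Real.pi * Complex.I * η) (by simp) (by simp)
  rw [Real.rpow_natCast, mul_assoc, ← mul_pow]
  refine h1.trans ?_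
  have h2 := abs_le_bracket η
  have h3 := one_le_bracket η
  have h4 : ‖(2 * Real.pi * Complex.I * η : ℂ)‖ = 2 * Real.pi * |η| := by
    simp [abs_of_pos Real.pi_pos]
  rw [h4]
  gcongr
  nlinarith [Real.pi_pos]

/-- A localised distribution is again the extension of an element of ℰ'[0,1], so the Fourier
criterion for H^r applies to it. -/
theorem extend_comp_mulSmooth (u : UnitDistribution) (φ : ℝ → ℂ) (hφ : ContDiff ℝ ∞ φ)
    (hφc : HasCompactSupport φ) :
    extend (u.comp (mulSmooth φ hφ)) = smulLeftCLM ℂ φ u.extend := by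
  ext f
  rw [smulLeftCLM_apply_apply, extend_apply, extend_apply]
  change u _ = u _
  congr 1
  apply Subtype.ext
  funext τ
  change φ τ * f τ = SchwartzMap.smulLeftCLM ℂ φ f τ
  rw [SchwartzMap.smulLeftCLM_apply_apply (hφc.hasTemperateGrowth hφ), smul_eq_mul]

/-- This is `fourier_extend_apply` tested on the inverse Fourier transform of φ times the character
of frequency ξ, which is the translated reflection η ↦ (𝓕 φ)(ξ - η). -/
theorem fourierFun_comp_mulSmooth (u : UnitDistribution) (φ : ℝ → ℂ) (hφ : ContDiff ℝ ∞ φ)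
    (hφc : HasCompactSupport φ) (ξ : ℝ) :
    fourierFun (u.comp (mulSmooth φ hφ)) ξ =
      schwartzConv (𝓕 (hφc.toSchwartzMap hφ)) u.fourierFun ξ := by
  have hch : ContDiff ℝ ∞ (expChar ξ) := by
    unfold expChar
    exact (contDiff_const.mul Complex.ofRealCLM.contDiff).cexp
  let ψ : 𝓢(ℝ, ℂ) := (hφc.mul_right (f' := expChar ξ)).toSchwartzMap (hφ.mul hch)
  have hψ (t : ℝ) : ψ t = φ t * expChar ξ t := rfl
  have h := u.fourier_extend_apply (𝓕⁻ ψ)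
  rw [TemperedDistribution.fourier_apply, FourierTransform.fourier_fourierInv_eq, extend_apply] at h
  have h1 (η : ℝ) : (𝓕⁻ ψ : 𝓢(ℝ, ℂ)) η = (𝓕 (hφc.toSchwartzMap hφ) : 𝓢(ℝ, ℂ)) (ξ - η) := by
    rw [SchwartzMap.fourierInv_coe, SchwartzMap.fourier_coe, Real.fourierInv_eq',
      Real.fourier_eq']
    congr 1
    funext t
    simp only [hψ, expChar, smul_eq_mul, HasCompactSupport.toSchwartzMap_toFun,
      RCLike.inner_apply, conj_trivial]
    rw [mul_left_comm, ← Complex.exp_add, mul_comm]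
    congr 2
    push_cast
    ring
  rw [schwartzConv]
  simp_rw [← h1]
  refine Eq.trans ?_ h
  change u (mulSmooth φ hφ (expAffine 0 _)) = _
  congr 1
  apply Subtype.ext
  funext τ
  change φ τ * Complex.exp _ = φ τ * expChar ξ τ
  rw [expChar]
  congr 2
  ring

theorem memSobolev_extend_iff (u : UnitDistribution) (r : ℝ) : MemSobolev r 2 u.extend ↔
    MemLp (fun η => ((bracket η ^ r : ℝ) : ℂ) * u.fourierFun η) 2 :=
  memSobolev_two_iff_memLp u.hasSlowGrowth_fourierFun u.fourier_extend_apply r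

theorem memSobolevLoc_iff (u : UnitDistribution) (r : ℝ) : u.MemSobolevLoc r ↔
    ∀ (φ : ℝ → ℂ) (hφ : ContDiff ℝ ∞ φ) (hφc : HasCompactSupport φ), tsupport φ ⊆ Ioo 0 1 →
      MemLp (fun η => ((bracket η ^ r : ℝ) : ℂ) *
        schwartzConv (𝓕 (hφc.toSchwartzMap hφ)) u.fourierFun η) 2 := by
  refine forall_congr' fun φ => forall_congr' fun hφ => forall_congr' fun hφc =>
    forall_congr' fun _ => ?_
  rw [← extend_comp_mulSmooth u φ hφ hφc, memSobolev_extend_iff]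
  simp_rw [fourierFun_comp_mulSmooth u φ hφ hφc]

end UnitDistribution

/-! ### Symbols from holomorphic extension -/

/-- Sequences of successive derivatives of a symbol of some order `M`. -/
structure IsSymbolSeq (S : ℕ → ℝ → ℂ) (M : ℝ) : Prop where
  hasDerivAt : ∀ n η, HasDerivAt (S n) (S (n + 1) η) η
  bound : ∀ n : ℕ, ∃ C : ℝ, ∀ η, ‖S n η‖ ≤ C * bracket η ^ (M - n)

/-- A holomorphic function of polynomial growth on the discs of radius `ε⟨ξ⟩` about the real points
`ξ` restricts to a symbol. -/
theorem isSymbolSeq_iteratedDeriv {G : ℂ → ℂ} {Ω : Set ℂ} (hΩ : IsOpen Ω)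
    (hG : DifferentiableOn ℂ G Ω) {ε C M : ℝ} (hε : 0 < ε)
    (h : ∀ (ξ : ℝ) (z : ℂ), ‖z - ξ‖ ≤ ε * bracket ξ → z ∈ Ω ∧ ‖G z‖ ≤ C * bracket ξ ^ M) :
    IsSymbolSeq (fun n ξ => iteratedDeriv n G ξ) M where
  hasDerivAt n η := by
    have hη : (η : ℂ) ∈ Ω := (h η η (by
      have := bracket_pos η
      rw [sub_self, norm_zero]; positivity)).1
    have h1 : AnalyticAt ℂ G η := hG.analyticAt (hΩ.mem_nhds hη)
    have h2 := (h1.iterated_deriv n).differentiableAt.hasDerivAt.comp_ofReal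
    rwa [← iteratedDeriv_eq_iterate, ← iteratedDeriv_succ] at h2
  bound n := by
    refine ⟨n.factorial * C / ε ^ n, fun η => ?_⟩
    have hb := bracket_pos η
    have hball : Metric.closedBall (η : ℂ) (ε * bracket η) ⊆ Ω := fun z hz =>
      (h η z (by rwa [← dist_eq_norm])).1
    -- Cauchy's estimate on a circle of radius ε⟨η⟩ gains a factor ⟨η⟩⁻¹ per derivative.
    have h1 := Complex.norm_iteratedDeriv_le_of_forall_mem_sphere_norm_le n (by positivity)
      (hG.diffContOnCl_ball hball) (C := C * bracket η ^ M) fun z hz =>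
        (h η z (by rw [← dist_eq_norm]; exact (Metric.mem_sphere.1 hz).le)).2
    refine h1.trans (le_of_eq ?_)
    rw [Real.rpow_sub hb, Real.rpow_natCast, mul_pow]
    field_simp

/-- The holomorphic extension of `X ↦ √(X² + κ²)`. -/
def sqrtAddSq (κ : ℝ) (z : ℂ) : ℂ := (z ^ 2 + (κ : ℂ) ^ 2) ^ (2⁻¹ : ℂ)

theorem sqrtAddSq_ofReal (κ X : ℝ) : sqrtAddSq κ X = (√(X ^ 2 + κ ^ 2) : ℝ) := by
  rw [sqrtAddSq, Real.sqrt_eq_rpow, Complex.ofReal_cpow (by positivity)]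
  push_cast
  norm_num

theorem differentiableAt_sqrtAddSq {κ : ℝ} {z : ℂ} (h : z ^ 2 + (κ : ℂ) ^ 2 ∈ Complex.slitPlane) :
    DifferentiableAt ℂ (sqrtAddSq κ) z :=
  ((differentiableAt_id.pow 2).add_const _).cpow_const h

/-- On the disc, z² + κ² stays within 3/8 · W² of W² = X² + κ², hence in the right half plane, away
from the branch cut and of size comparable to W². -/
theorem sqrtAddSq_bounds {κ X : ℝ} (hκ : 0 < κ) {z : ℂ}
    (hz : ‖z - X‖ ≤ 1 / 8 * √(X ^ 2 + κ ^ 2)) :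
    z ^ 2 + (κ : ℂ) ^ 2 ∈ Complex.slitPlane ∧ √(X ^ 2 + κ ^ 2) / 2 ≤ (sqrtAddSq κ z).re ∧
      ‖sqrtAddSq κ z‖ ≤ 2 * √(X ^ 2 + κ ^ 2) := by
  set W := √(X ^ 2 + κ ^ 2) with hW
  have hW0 : 0 < W := Real.sqrt_pos.2 (by positivity)
  have hWsq : W ^ 2 = X ^ 2 + κ ^ 2 := Real.sq_sqrt (by positivity)
  have hXW : |X| ≤ W := Real.abs_le_sqrt (by nlinarith [sq_nonneg κ])
  set Q := z ^ 2 + (κ : ℂ) ^ 2 with hQ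
  have h1 : ‖Q - (W ^ 2 : ℝ)‖ ≤ 3 / 8 * W ^ 2 := by
    have : Q - (W ^ 2 : ℝ) = (z - X) * ((z - X) + 2 * X) := by
      rw [hQ, hWsq]; push_cast; ring
    rw [this, norm_mul]
    have h2 : ‖(z - X) + 2 * (X : ℂ)‖ ≤ 1 / 8 * W + 2 * W := by
      refine (norm_add_le _ _).trans (add_le_add hz ?_)
      simpa using hXW
    calc _ ≤ (1 / 8 * W) * (1 / 8 * W + 2 * W) := by gcongr
      _ ≤ _ := by nlinarith
  have hre : 5 / 8 * W ^ 2 ≤ Q.re := by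
    have h3 := (abs_le.1 ((Complex.abs_re_le_norm _).trans h1)).1
    rw [Complex.sub_re, Complex.ofReal_re] at h3
    linarith
  have hnorm : ‖Q‖ ≤ 2 * W ^ 2 := by
    have h3 : ‖Q‖ ≤ ‖Q - (W ^ 2 : ℝ)‖ + ‖((W ^ 2 : ℝ) : ℂ)‖ := norm_le_norm_sub_add Q _
    rw [Complex.norm_real, Real.norm_of_nonneg (by positivity)] at h3
    nlinarith
  refine ⟨Or.inl (by nlinarith), ?_, ?_⟩
  -- Re √Q = √((|Q| + Re Q)/2) ≥ √(Re Q), and Re Q ≥ 5/8 · W².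
  · rw [sqrtAddSq, Complex.cpow_inv_two_re]
    refine Real.le_sqrt_of_sq_le ?_
    have := Complex.re_le_norm Q
    nlinarith
  · have h4 : ‖sqrtAddSq κ z‖ ^ 2 = ‖Q‖ := by
      rw [← norm_pow, sqrtAddSq]
      congr 1
      exact Complex.cpow_ofNat_inv_pow Q 2
    nlinarith [norm_nonneg (sqrtAddSq κ z)]

/-- Together with `sqrt_le_mul_bracket`, this makes W comparable to ⟨ξ⟩, so discs of radius
proportional to either can be exchanged. -/
theorem min_mul_bracket_le {t κ : ℝ} (ht : 0 < t) (hκ : 0 < κ) (ξ : ℝ) :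
    min t κ * bracket ξ ≤ √((t * ξ) ^ 2 + κ ^ 2) := by
  have hm := lt_min ht hκ
  refine Real.le_sqrt_of_sq_le ?_
  rw [mul_pow, bracket_sq, mul_pow]
  have e1 : min t κ ^ 2 ≤ t ^ 2 := pow_le_pow_left₀ hm.le (min_le_left _ _) 2
  have e2 : min t κ ^ 2 ≤ κ ^ 2 := pow_le_pow_left₀ hm.le (min_le_right _ _) 2
  nlinarith [sq_nonneg ξ]

theorem sqrt_le_mul_bracket {t κ : ℝ} (ht : 0 < t) (hκ : 0 < κ) (ξ : ℝ) :
    √((t * ξ) ^ 2 + κ ^ 2) ≤ (t + κ) * bracket ξ := by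
  refine Real.sqrt_le_iff.2 ⟨by have := bracket_pos ξ; positivity, ?_⟩
  rw [mul_pow, mul_pow, bracket_sq]
  have e1 : t ^ 2 ≤ (t + κ) ^ 2 := pow_le_pow_left₀ ht.le (by linarith) 2
  have e2 : κ ^ 2 ≤ (t + κ) ^ 2 := pow_le_pow_left₀ hκ.le (by linarith) 2
  nlinarith [sq_nonneg ξ]

/-- `u` applied to `exp(-(iXx + √(X² + κ²) y))`, where `(x, y)` runs linearly through a segment that
lies in a cone with vertex `0` in the upper half plane, is a symbol in `ξ`, with `X = tξ`. -/
theorem exists_isSymbolSeq {κ t δ a b a' b' : ℝ} (hκ : 0 < κ) (ht : 0 < t) (hδ : 0 < δ)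
    (h0 : δ * |a| ≤ b) (h1 : δ * |a + a'| ≤ b + b') (u v : UnitDistribution) (c d : ℂ) :
    ∃ (S : ℕ → ℝ → ℂ) (M : ℝ), IsSymbolSeq S M ∧ ∀ ξ : ℝ,
      S 0 ξ = Complex.exp (-(Complex.I * (t * ξ : ℝ) * a + √((t * ξ) ^ 2 + κ ^ 2) * b)) *
        (u.laplace (Complex.I * (t * ξ : ℝ) * a' + √((t * ξ) ^ 2 + κ ^ 2) * b') +
          (c * (t * ξ : ℝ) + d * √((t * ξ) ^ 2 + κ ^ 2)) *
          v.laplace (Complex.I * (t * ξ : ℝ) * a' + √((t * ξ) ^ 2 + κ ^ 2) * b')) := by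
  let V : ℂ → ℂ := fun z => sqrtAddSq κ (t * z)
  let A : ℂ → ℂ := fun z => Complex.I * (t * z) * a + V z * b
  let B : ℂ → ℂ := fun z => Complex.I * (t * z) * a' + V z * b'
  let G : ℂ → ℂ := fun z => Complex.exp (-A z) *
    (u.laplace (B z) + (c * (t * z) + d * V z) * v.laplace (B z))
  let Ω : Set ℂ := {z | (t * z) ^ 2 + (κ : ℂ) ^ 2 ∈ Complex.slitPlane}
  have hΩ : IsOpen Ω := Complex.isOpen_slitPlane.preimage (by fun_prop)
  have hV : DifferentiableOn ℂ V Ω := fun z hz =>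
    ((differentiableAt_sqrtAddSq hz).comp z
      (differentiableAt_id.const_mul (t : ℂ))).differentiableWithinAt
  have hA : DifferentiableOn ℂ A Ω := by fun_prop
  have hB : DifferentiableOn ℂ B Ω := by fun_prop
  have hu := u.differentiable_laplace.comp_differentiableOn hB
  have hv := v.differentiable_laplace.comp_differentiableOn hB
  have hG : DifferentiableOn ℂ G Ω :=
    hA.neg.cexp.mul (hu.add ((DifferentiableOn.add (by fun_prop) (hV.const_mul d)).mul hv))
  obtain ⟨C₁, N₁, hC₁, hb₁⟩ := u.exists_norm_apply_expAffine_le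
  obtain ⟨C₂, N₂, hC₂, hb₂⟩ := v.exists_norm_apply_expAffine_le
  set N := max N₁ N₂
  set m := min t κ with hm
  have hm0 : 0 < m := lt_min ht hκ
  -- The bound 1/8 is what `sqrtAddSq_bounds` needs; δ/2 lets the cone condition absorb the
  -- imaginary part of tz.
  set ε := min (1 / 8) (δ / 2) with hεdef
  have hε : 0 < ε := lt_min (by norm_num) (by linarith)
  have hε1 : ε ≤ 1 / 8 := min_le_left _ _
  have hε2 : ε ≤ δ / 2 := min_le_right _ _
  set K := t + κ with hK
  have hK0 : 0 < K := by positivity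
  have hWlow (ξ : ℝ) : m * bracket ξ ≤ √((t * ξ) ^ 2 + κ ^ 2) := min_mul_bracket_le ht hκ ξ
  have hWup (ξ : ℝ) : √((t * ξ) ^ 2 + κ ^ 2) ≤ K * bracket ξ := sqrt_le_mul_bracket ht hκ ξ
  set L := 1 + 2 * K * (|a'| + |b'|) with hL
  have hL1 : 1 ≤ L := by
    have : 0 ≤ 2 * K * (|a'| + |b'|) := by positivity
    linarith
  -- The order is N from the growth of `u` and `v`, plus 1 from the coefficient c·tz + d·V. The
  -- radius is chosen so that tz stays within εW of tξ.
  refine ⟨_, N + 1, isSymbolSeq_iteratedDeriv hΩ hG (ε := ε * m / t)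
    (C := L ^ N * (C₁ + 2 * K * (‖c‖ + ‖d‖) * C₂)) (by positivity) ?_, fun ξ => ?_⟩
  · intro ξ z hz
    set W := √((t * ξ) ^ 2 + κ ^ 2) with hW
    have hb := one_le_bracket ξ
    have hb0 := bracket_pos ξ
    have hW0 : 0 < W := Real.sqrt_pos.2 (by positivity)
    have hz' : ‖t * z - (t * ξ : ℝ)‖ ≤ ε * W := by
      rw [Complex.ofReal_mul, ← mul_sub, norm_mul, Complex.norm_real, Real.norm_of_nonneg ht.le]
      calc t * ‖z - ξ‖ ≤ t * (ε * m / t * bracket ξ) := by gcongr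
        _ = ε * (m * bracket ξ) := by field_simp
        _ ≤ _ := by gcongr; exact hWlow ξ
    obtain ⟨hs, hre, hnorm⟩ := sqrtAddSq_bounds hκ (hz'.trans (by gcongr))
    change W / 2 ≤ (V z).re at hre
    change ‖V z‖ ≤ 2 * W at hnorm
    have hzn : ‖(t * z : ℂ)‖ ≤ 2 * W := by
      have h2 : ‖(t * z : ℂ)‖ ≤ ‖t * z - (t * ξ : ℝ)‖ + ‖((t * ξ : ℝ) : ℂ)‖ :=
        norm_le_norm_sub_add _ _
      have h3 : ‖((t * ξ : ℝ) : ℂ)‖ ≤ W := by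
        rw [Complex.norm_real]
        exact Real.abs_le_sqrt (by nlinarith [sq_nonneg κ])
      nlinarith
    have him : |(t * z : ℂ).im| ≤ ε * W := by
      have := (Complex.abs_im_le_norm _).trans hz'
      rwa [Complex.sub_im, Complex.ofReal_im, sub_zero] at this
    -- The real part is at least (W/2)y - εW|x|, which is nonnegative since ε ≤ δ/2 and δ|x| ≤ y.
    have hpos (x y : ℝ) (hxy : δ * |x| ≤ y) : 0 ≤ (Complex.I * (t * z) * x + V z * y).re := by
      have e : (Complex.I * (t * z) * x + V z * y).re = -((t * z : ℂ).im * x) + (V z).re * y := by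
        rw [Complex.add_re, Complex.re_mul_ofReal, Complex.re_mul_ofReal, Complex.I_mul_re]
        ring
      rw [e]
      have hy : 0 ≤ y := le_trans (by positivity) hxy
      have e1 : (t * z : ℂ).im * x ≤ ε * W * |x| :=
        (le_abs_self _).trans (by rw [abs_mul]; gcongr)
      have e2 : W / 2 * y ≤ (V z).re * y := by gcongr
      have e3 : ε * W * |x| ≤ δ / 2 * W * |x| := by gcongr
      nlinarith
    have hAre : 0 ≤ (A z).re := hpos a b h0
    have hABre : 0 ≤ (A z + B z).re := by
      have : A z + B z = Complex.I * (t * z) * (a + a' : ℝ) + V z * (b + b' : ℝ) := by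
        simp only [A, B]; push_cast; ring
      rw [this]
      exact hpos _ _ h1
    have hBn : 1 + ‖B z‖ ≤ L * bracket ξ := by
      have e1 : ‖B z‖ ≤ 2 * W * |a'| + 2 * W * |b'| := by
        refine (norm_add_le _ _).trans ?_
        rw [norm_mul, norm_mul, norm_mul (V z), Complex.norm_I, one_mul, Complex.norm_real,
          Complex.norm_real, Real.norm_eq_abs, Real.norm_eq_abs]
        gcongr
      have e2 : 2 * W * (|a'| + |b'|) ≤ 2 * (K * bracket ξ) * (|a'| + |b'|) := by
        gcongr
        exact hWup ξ
      rw [hL]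
      nlinarith
    have hpw {n : ℕ} (hn : n ≤ N) : (1 + ‖B z‖) ^ n ≤ L ^ N * bracket ξ ^ N := by
      rw [← mul_pow]
      calc (1 + ‖B z‖) ^ n ≤ (L * bracket ξ) ^ n := by gcongr
        _ ≤ _ := pow_le_pow_right₀ (by nlinarith) hn
    have hu1 := (hb₁ (A z) (B z) hAre hABre).trans
      (mul_le_mul_of_nonneg_left (hpw (le_max_left N₁ N₂)) hC₁)
    have hv1 := (hb₂ (A z) (B z) hAre hABre).trans
      (mul_le_mul_of_nonneg_left (hpw (le_max_right N₁ N₂)) hC₂)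
    refine ⟨hs, ?_⟩
    have hGz : G z = u (SmoothUnit.expAffine (A z) (B z)) +
        (c * (t * z) + d * V z) * v (SmoothUnit.expAffine (A z) (B z)) := by
      rw [u.apply_expAffine, v.apply_expAffine]
      simp only [G]
      ring
    have hcd : ‖c * (t * z) + d * V z‖ ≤ 2 * K * (‖c‖ + ‖d‖) * bracket ξ := by
      refine (norm_add_le _ _).trans ?_
      rw [norm_mul, norm_mul d]
      calc ‖c‖ * ‖(t * z : ℂ)‖ + ‖d‖ * ‖V z‖ ≤ ‖c‖ * (2 * W) + ‖d‖ * (2 * W) := by gcongr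
        _ = 2 * W * (‖c‖ + ‖d‖) := by ring
        _ ≤ 2 * (K * bracket ξ) * (‖c‖ + ‖d‖) := by gcongr; exact hWup ξ
        _ = _ := by ring
    rw [hGz]
    refine (norm_add_le _ _).trans ?_
    rw [norm_mul, Real.rpow_add hb0, Real.rpow_natCast, Real.rpow_one]
    have e1 : ‖u (SmoothUnit.expAffine (A z) (B z))‖ ≤ C₁ * (L ^ N * bracket ξ ^ N) * bracket ξ :=
      hu1.trans (le_mul_of_one_le_right (by positivity) hb)
    have e2 := mul_le_mul hcd hv1 (norm_nonneg _) (by positivity)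
    refine (add_le_add e1 e2).trans (le_of_eq ?_)
    ring
  · have hVξ : V ξ = √((t * ξ) ^ 2 + κ ^ 2) := by
      rw [← sqrtAddSq_ofReal, Complex.ofReal_mul]
    simp only [iteratedDeriv_zero, G, A, B, hVξ, Complex.ofReal_mul]

/-! ### Geometry of the convex polygon seen from one side -/

namespace Polygon

variable {n : ℕ}

theorem IsConvexCCW.finRotate_ne {P : Polygon ℂ n} (hP : P.IsConvexCCW) (i : Fin n) :
    finRotate n i ≠ i ∧ finRotate n (finRotate n i) ≠ i := by
  obtain ⟨m, rfl⟩ := Nat.exists_eq_add_of_le' hP.1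
  simp only [finRotate_apply, add_assoc, ne_eq, add_eq_left]
  constructor
  · exact Fin.ne_of_val_ne (by simp)
  · intro h
    have h2 := congrArg Fin.val h
    rw [Fin.val_add, Fin.val_one, Fin.val_zero, Nat.mod_eq_of_lt (by omega)] at h2
    omega

/-- The unit vector in direction of the side `Γ_i`. -/
def sideDir (P : Polygon ℂ n) (i : Fin n) : ℂ := Complex.exp (Complex.I * P.sideAngle i)

theorem conj_sideDir_mul (P : Polygon ℂ n) (i : Fin n) : conj (P.sideDir i) * P.sideDir i = 1 := by
  rw [sideDir, ← Complex.exp_conj, ← Complex.exp_add]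
  simp

theorem sub_eq_sideLength_mul (P : Polygon ℂ n) (i : Fin n) :
    P (finRotate n i) - P i = P.sideLength i * P.sideDir i := by
  rw [sideLength, sideDir, sideAngle, mul_comm Complex.I, Complex.norm_mul_exp_arg_mul_I]

/-- The `j`-th vertex in the coordinates with origin `z_i` and first axis along the side `Γ_i`. -/
def localVertex (P : Polygon ℂ n) (i j : Fin n) : ℂ := conj (P.sideDir i) * (P j - P i)

theorem sub_eq_mul_localVertex (P : Polygon ℂ n) (i j : Fin n) :
    P j - P i = P.sideDir i * P.localVertex i j := by
  rw [localVertex, ← mul_assoc, mul_comm (P.sideDir i), conj_sideDir_mul, one_mul]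

theorem localVertex_self (P : Polygon ℂ n) (i : Fin n) : P.localVertex i i = 0 := by
  simp [localVertex]

theorem localVertex_finRotate (P : Polygon ℂ n) (i : Fin n) :
    P.localVertex i (finRotate n i) = P.sideLength i := by
  rw [localVertex, sub_eq_sideLength_mul, mul_left_comm, conj_sideDir_mul, mul_one]

/-- The length remains as a factor because its positivity is itself deduced from this inequality. -/
theorem IsConvexCCW.im_conj_mul_pos {P : Polygon ℂ n} (hP : P.IsConvexCCW) {i j : Fin n}
    (hj : j ≠ i) (hj' : j ≠ finRotate n i) : 0 < P.sideLength i * (P.localVertex i j).im := by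
  have h := hP.2 i j hj hj'
  rwa [sub_eq_sideLength_mul, map_mul, Complex.conj_ofReal, mul_assoc, Complex.im_ofReal_mul] at h

/-- If the length were zero, the strict convexity inequality for the third vertex z_{i+2} would read
0 < 0. -/
theorem IsConvexCCW.sideLength_pos {P : Polygon ℂ n} (hP : P.IsConvexCCW) (i : Fin n) :
    0 < P.sideLength i := by
  refine (norm_nonneg _).lt_of_ne fun h => ?_
  have h1 := hP.im_conj_mul_pos (hP.finRotate_ne i).2 (hP.finRotate_ne (finRotate n i)).1
  rw [show P.sideLength i = 0 from h.symm, zero_mul] at h1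
  exact h1.false

theorem IsConvexCCW.localVertex_im_pos {P : Polygon ℂ n} (hP : P.IsConvexCCW) {i j : Fin n}
    (hj : j ≠ i) (hj' : j ≠ finRotate n i) : 0 < (P.localVertex i j).im :=
  pos_of_mul_pos_right (hP.im_conj_mul_pos hj hj') (hP.sideLength_pos i).le

/-- Seen from one of the two end points of `Γ_i`, any other side lies in a cone of opening angle
less than `π`. -/
theorem IsConvexCCW.exists_cone {P : Polygon ℂ n} (hP : P.IsConvexCCW) {i j : Fin n}
    (hj : j ≠ i) : ∃ p : ℝ, (p = 0 ∨ p = 1) ∧ ∃ δ > 0,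
      δ * |(P.localVertex i j).re - p * P.sideLength i| ≤ (P.localVertex i j).im ∧
      δ * |(P.localVertex i (finRotate n j)).re - p * P.sideLength i|
        ≤ (P.localVertex i (finRotate n j)).im := by
  have cone (p : ℝ) (w : ℂ) (hw : w = (p * P.sideLength i : ℝ) ∨ 0 < w.im) :
      ∃ δ > 0, δ * |w.re - p * P.sideLength i| ≤ w.im := by
    rcases hw with hw | hw
    · refine ⟨1, one_pos, ?_⟩
      rw [hw, Complex.ofReal_re, Complex.ofReal_im, sub_self, abs_zero, mul_zero]
    · refine ⟨w.im / (1 + |w.re - p * P.sideLength i|), by positivity, ?_⟩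
      rw [div_mul_eq_mul_div, div_le_iff₀ (by positivity)]
      nlinarith
  have key (p : ℝ) (hp : p = 0 ∨ p = 1)
      (h1 : P.localVertex i j = (p * P.sideLength i : ℝ) ∨ 0 < (P.localVertex i j).im)
      (h2 : P.localVertex i (finRotate n j) = (p * P.sideLength i : ℝ) ∨
        0 < (P.localVertex i (finRotate n j)).im) : ∃ p : ℝ, (p = 0 ∨ p = 1) ∧ ∃ δ > 0,
      δ * |(P.localVertex i j).re - p * P.sideLength i| ≤ (P.localVertex i j).im ∧
      δ * |(P.localVertex i (finRotate n j)).re - p * P.sideLength i|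
        ≤ (P.localVertex i (finRotate n j)).im := by
    obtain ⟨δ₁, hδ₁, h1⟩ := cone p _ h1
    obtain ⟨δ₂, hδ₂, h2⟩ := cone p _ h2
    refine ⟨p, hp, min δ₁ δ₂, lt_min hδ₁ hδ₂, le_trans ?_ h1, le_trans ?_ h2⟩
    · gcongr
      exact min_le_left _ _
    · gcongr
      exact min_le_right _ _
  -- The side after Γ_i starts at z_{i+1}, so p = 1. Any other side either ends at z_i or has both
  -- end points strictly above the line of Γ_i, and p = 0 serves for both.
  by_cases h : j = finRotate n i
  · subst h
    refine key 1 (Or.inr rfl) (Or.inl ?_) (Or.inr ?_)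
    · rw [localVertex_finRotate, one_mul]
    · exact hP.localVertex_im_pos (hP.finRotate_ne i).2 (hP.finRotate_ne (finRotate n i)).1
  · refine key 0 (Or.inl rfl) (Or.inr (hP.localVertex_im_pos hj h)) ?_
    by_cases h' : finRotate n j = i
    · left
      rw [h', localVertex_self, zero_mul, Complex.ofReal_zero]
    · right
      exact hP.localVertex_im_pos h' fun h2 => hj ((finRotate n).injective h2)

end Polygon

/-! ### The global relation on a ray -/

theorem planeExp_add (β : ℝ) (l z w : ℂ) :
    planeExp β l (z + w) = planeExp β l z * planeExp β l w := by
  rw [planeExp, planeExp, planeExp, ← Complex.exp_add]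
  congr 1
  rw [map_add]
  ring

theorem planeExp_ne_zero (β : ℝ) (l z : ℂ) : planeExp β l z ≠ 0 := Complex.exp_ne_zero _

/-- With `λ = k / e`, where `k < 0` and `k - β²/k = X`, the plane exponential is bounded and
oscillating along the direction `e` and decaying to its left. -/
theorem planeExp_rotate {β X k : ℝ} (hk : k ≠ 0) (hX : k - β ^ 2 / k = X) {e : ℂ}
    (he : conj e * e = 1) (w : ℂ) : planeExp β (k * conj e) (e * w) =
      Complex.exp (-(Complex.I * X * w.re + ((X - 2 * k : ℝ) : ℂ) * w.im)) := by
  have hk' : (k : ℂ) ≠ 0 := Complex.ofReal_ne_zero.2 hk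
  have he0 : conj e ≠ 0 := left_ne_zero_of_mul_eq_one he
  have hβ : (β : ℂ) ^ 2 = k * (k - X) := by
    have : β ^ 2 = k * (k - X) := by rw [← hX]; field_simp; ring
    exact_mod_cast this
  rw [planeExp]
  congr 1
  have h1 : -Complex.I * (k * conj e) * (e * w) = -Complex.I * k * w := by
    linear_combination (-Complex.I * k * w) * he
  have h2 : Complex.I * (β : ℂ) ^ 2 * conj (e * w) / (k * conj e)
      = Complex.I * (k - X) * conj w := by
    rw [hβ, map_mul]
    field_simp
  have h3 : conj w = w.re - w.im * Complex.I := by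
    apply Complex.ext <;> simp
  have h4 : (w.re : ℂ) + w.im * Complex.I = w := Complex.re_add_im w
  rw [h1, h2, h3]
  push_cast
  linear_combination (Complex.I * k) * h4 + (X - 2 * k : ℂ) * w.im * Complex.I_sq

/-- The side Γ_j is affine in τ in the local coordinates of Γ_i. The scalar in front does not depend
on j, so it drops out of the global relation. -/
theorem pullback_planeExp {n : ℕ} (P : Polygon ℂ n) (i j : Fin n) {β X k : ℝ} (hk : k ≠ 0)
    (hX : k - β ^ 2 / k = X) :
    P.pullback j (planeExp β (k * conj (P.sideDir i))) (contDiff_planeExp β _) =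
      planeExp β (k * conj (P.sideDir i)) (P i) • SmoothUnit.expAffine
        (Complex.I * X * (P.localVertex i j).re + ((X - 2 * k : ℝ) : ℂ) * (P.localVertex i j).im)
        (Complex.I * X * ((P.localVertex i (finRotate n j)).re - (P.localVertex i j).re : ℝ) +
          ((X - 2 * k : ℝ) : ℂ) *
            ((P.localVertex i (finRotate n j)).im - (P.localVertex i j).im : ℝ)) := by
  apply Subtype.ext
  funext τ
  change planeExp β _ (P.sideParam j τ) = planeExp β _ (P i) * Complex.exp _
  have h : P.sideParam j τ = P i + P.sideDir i * (P.localVertex i j +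
      (τ : ℝ) * (P.localVertex i (finRotate n j) - P.localVertex i j)) := by
    rw [mul_add, mul_left_comm, mul_sub, ← P.sub_eq_mul_localVertex, ← P.sub_eq_mul_localVertex,
      Polygon.sideParam]
    ring
  rw [h, planeExp_add, planeExp_rotate hk hX (P.conj_sideDir_mul i)]
  congr 2
  simp only [Complex.add_re, Complex.add_im, Complex.re_ofReal_mul, Complex.im_ofReal_mul,
    Complex.sub_re, Complex.sub_im]
  push_cast
  ring

open UnitDistribution

/-- The global relation on the ray `{λ : λ e^{iα_i} < 0}`, parametrised by `X = k - β²/k ∈ ℝ`,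
where `k = λ e^{iα_i}`. -/
theorem GlobalRelation.sum_eq_zero {n : ℕ} {P : Polygon ℂ n} {β : ℝ} (hβ : 0 < β ^ 2)
    {q dq : Fin n → UnitDistribution} (hgr : GlobalRelation P β q dq) (i : Fin n) (X : ℝ) :
    ∑ j, (P.sideLength j : ℂ) * (Complex.exp (-(Complex.I * X * (P.localVertex i j).re +
        √(X ^ 2 + (2 * |β|) ^ 2) * (P.localVertex i j).im)) *
      ((dq j).laplace (Complex.I * X *
          ((P.localVertex i (finRotate n j)).re - (P.localVertex i j).re : ℝ) +
          √(X ^ 2 + (2 * |β|) ^ 2) *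
            ((P.localVertex i (finRotate n j)).im - (P.localVertex i j).im : ℝ)) +
        ((conj (P.sideDir i) * P.sideDir j - (conj (P.sideDir i) * P.sideDir j)⁻¹) / 2 * X +
            -((conj (P.sideDir i) * P.sideDir j + (conj (P.sideDir i) * P.sideDir j)⁻¹) / 2) *
              √(X ^ 2 + (2 * |β|) ^ 2)) *
        (q j).laplace (Complex.I * X *
          ((P.localVertex i (finRotate n j)).re - (P.localVertex i j).re : ℝ) +
          √(X ^ 2 + (2 * |β|) ^ 2) *
            ((P.localVertex i (finRotate n j)).im - (P.localVertex i j).im : ℝ)))) = 0 := by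
  set W := √(X ^ 2 + (2 * |β|) ^ 2) with hW
  have hWsq : W ^ 2 = X ^ 2 + 4 * β ^ 2 := by
    rw [hW, Real.sq_sqrt (by positivity), mul_pow, sq_abs]
    norm_num
  have hXW : X < W := by
    refine Real.lt_sqrt_of_sq_lt ?_
    rw [mul_pow, sq_abs]
    linarith
  -- The negative root of k² - Xk - β² = 0; it gives X - 2k = W > 0, so the exponential decays into
  -- the polygon.
  set k := (X - W) / 2 with hk
  have hk0 : k ≠ 0 := by
    have : k < 0 := by linarith
    exact this.ne
  have hβk : β ^ 2 / k = -((X + W) / 2) := by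
    rw [div_eq_iff hk0, hk]
    linarith
  have hX : k - β ^ 2 / k = X := by rw [hβk]; ring
  have hX2 : X - 2 * k = W := by rw [hk]; ring
  have he : conj (P.sideDir i) ≠ 0 := left_ne_zero_of_mul_eq_one (P.conj_sideDir_mul i)
  have hkC : (k : ℂ) ≠ 0 := Complex.ofReal_ne_zero.2 hk0
  have hk1 : (k : ℂ) = (X - W) / 2 := by rw [hk]; push_cast; ring
  have hk2 : (β : ℂ) ^ 2 / k = -((X + W) / 2) := by exact_mod_cast hβk
  have h := hgr (k * conj (P.sideDir i)) (mul_ne_zero hkC he)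
  rw [← mul_right_inj' (planeExp_ne_zero β (k * conj (P.sideDir i)) (P i)), mul_zero, ← h,
    Finset.mul_sum]
  refine Finset.sum_congr rfl fun j _ => ?_
  -- With r = conj(e_i) e_j for the side directions, kr + β²/(kr) = r(X - W)/2 - r⁻¹(X + W)/2, which
  -- is sorted by X and W in the statement.
  have hc : (β : ℂ) ^ 2 / (k * conj (P.sideDir i) * P.sideDir j)
      = (conj (P.sideDir i) * P.sideDir j)⁻¹ * -((X + W) / 2) := by
    rw [← hk2, mul_assoc, ← div_div, div_eq_mul_inv _ (conj _ * _), mul_comm]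
  rw [spectralFunction, pullback_planeExp P i j hk0 hX, map_smul, map_smul, apply_expAffine,
    apply_expAffine, hX2]
  change _ = _ * (_ + (k * conj (P.sideDir i) * P.sideDir j +
    (β : ℂ) ^ 2 / (k * conj (P.sideDir i) * P.sideDir j)) * _)
  rw [hc, hk1, smul_eq_mul, smul_eq_mul]
  ring

/-! ### The Dirichlet-to-Neumann relation and the conclusion -/

theorem IsSymbolSeq.hasSlowGrowth {S : ℕ → ℝ → ℂ} {M : ℝ} (hS : IsSymbolSeq S M) :
    HasSlowGrowth (S 0) :=
  ⟨continuous_iff_continuousAt.2 fun η => (hS.hasDerivAt 0 η).continuousAt,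
    (hS.bound 0).choose, _, (hS.bound 0).choose_spec⟩

/-- The `j`-th term of the global relation, `j ≠ i`, is a symbol up to an oscillating factor
coming from an end point of `Γ_i`. -/
theorem exists_isSymbolSeq_side {n : ℕ} {P : Polygon ℂ n} (hP : P.IsConvexCCW) {κ : ℝ}
    (hκ : 0 < κ) (u v : UnitDistribution) {i j : Fin n} (hj : j ≠ i) (c d : ℂ) :
    ∃ (S : ℕ → ℝ → ℂ) (M p : ℝ), IsSymbolSeq S M ∧ (p = 0 ∨ p = 1) ∧ ∀ ξ X : ℝ,
      X = 2 * Real.pi / P.sideLength i * ξ → expChar p ξ * S 0 ξ =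
      Complex.exp (-(Complex.I * X * (P.localVertex i j).re +
        √(X ^ 2 + κ ^ 2) * (P.localVertex i j).im)) *
      (u.laplace (Complex.I * X *
          ((P.localVertex i (finRotate n j)).re - (P.localVertex i j).re : ℝ) +
          √(X ^ 2 + κ ^ 2) *
            ((P.localVertex i (finRotate n j)).im - (P.localVertex i j).im : ℝ)) +
        (c * X + d * √(X ^ 2 + κ ^ 2)) *
        v.laplace (Complex.I * X *
          ((P.localVertex i (finRotate n j)).re - (P.localVertex i j).re : ℝ) +
          √(X ^ 2 + κ ^ 2) *
            ((P.localVertex i (finRotate n j)).im - (P.localVertex i j).im : ℝ))) := by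
  have hL := hP.sideLength_pos i
  obtain ⟨p, hp, δ, hδ, h0, h1⟩ := hP.exists_cone hj
  have h1' : δ * |(P.localVertex i j).re - p * P.sideLength i +
      ((P.localVertex i (finRotate n j)).re - (P.localVertex i j).re)| ≤
      (P.localVertex i j).im + ((P.localVertex i (finRotate n j)).im - (P.localVertex i j).im) := by
    convert h1 using 3 <;> ring
  obtain ⟨S, M, hS, hS0⟩ := exists_isSymbolSeq (t := 2 * Real.pi / P.sideLength i) hκ
    (by positivity) hδ h0 h1' u v c d
  refine ⟨S, M, p, hS, hp, fun ξ X hX => ?_⟩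
  rw [hS0, ← hX, ← mul_assoc, expChar, ← Complex.exp_add]
  congr 2
  -- With this scaling the phase exp(-iXx) at x = p|Γ_i| is exactly `expChar p ξ`.
  have h2 : (2 * Real.pi * ξ : ℂ) = X * P.sideLength i := by
    rw [hX]
    push_cast
    have : (P.sideLength i : ℂ) ≠ 0 := Complex.ofReal_ne_zero.2 hL.ne'
    field_simp
  push_cast
  linear_combination (-Complex.I * p) * h2

/-- On the Fourier side, the Dirichlet-to-Neumann map of a side is the multiplier `√(X² + 4β²)`
up to symbols that oscillate with the end points of the side. -/
theorem GlobalRelation.exists_fourierFun_eq {n : ℕ} {P : Polygon ℂ n} (hP : P.IsConvexCCW) {β : ℝ}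
    (hβ : 0 < β ^ 2) {q dq : Fin n → UnitDistribution} (hgr : GlobalRelation P β q dq)
    (i : Fin n) : ∃ (S : Fin n → ℕ → ℝ → ℂ) (M p : Fin n → ℝ) (C : Fin n → ℂ),
      (∀ j, j ≠ i → IsSymbolSeq (S j) (M j) ∧ (p j = 0 ∨ p j = 1)) ∧ ∀ ξ : ℝ,
      (dq i).fourierFun ξ =
        (√((2 * Real.pi / P.sideLength i * ξ) ^ 2 + (2 * |β|) ^ 2) : ℝ) * (q i).fourierFun ξ +
        ∑ j ∈ Finset.univ.erase i, C j * (expChar (p j) ξ * S j 0 ξ) := by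
  have hL : (P.sideLength i : ℂ) ≠ 0 := Complex.ofReal_ne_zero.2 (hP.sideLength_pos i).ne'
  have hκ : 0 < 2 * |β| := by
    have : β ≠ 0 := by rintro rfl; simp at hβ
    positivity
  have hex (j : Fin n) (hj : j ≠ i) := exists_isSymbolSeq_side hP hκ (dq j) (q j) hj
    ((conj (P.sideDir i) * P.sideDir j - (conj (P.sideDir i) * P.sideDir j)⁻¹) / 2)
    (-((conj (P.sideDir i) * P.sideDir j + (conj (P.sideDir i) * P.sideDir j)⁻¹) / 2))
  -- The values at j = i are arbitrary; only sums without the index i are formed.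
  choose! S M p hS hp hSp using hex
  refine ⟨S, M, p, fun j => -(P.sideLength j / P.sideLength i), fun j hj => ⟨hS j hj, hp j hj⟩,
    fun ξ => ?_⟩
  set X := 2 * Real.pi / P.sideLength i * ξ with hX
  have h := hgr.sum_eq_zero hβ i X
  have hXL : Complex.I * X * P.sideLength i = 2 * Real.pi * Complex.I * ξ := by
    rw [hX]
    push_cast
    field_simp
  rw [← Finset.add_sum_erase _ _ (Finset.mem_univ i),
    Finset.sum_congr rfl fun j hj => by rw [← hSp j (Finset.ne_of_mem_erase hj) ξ X hX],
    P.localVertex_finRotate, P.localVertex_self, P.conj_sideDir_mul] at h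
  -- For j = i the direction ratio is 1, so the coefficient of X vanishes and that of W is -1; the
  -- Laplace transforms are taken at iX|Γ_i| = 2πiξ.
  simp only [Complex.zero_re, Complex.zero_im, Complex.ofReal_re, Complex.ofReal_im, sub_zero,
    Complex.ofReal_zero, mul_zero, add_zero, neg_zero, Complex.exp_zero, one_mul, inv_one, sub_self,
    zero_div, zero_mul, zero_add, hXL] at h
  change _ * (fourierFun (dq i) ξ + _ * fourierFun (q i) ξ) + _ = 0 at h
  rw [← mul_right_inj' hL, mul_add, Finset.mul_sum]
  have h3 : ∑ j ∈ Finset.univ.erase i, (P.sideLength i : ℂ) *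
      (-(P.sideLength j / P.sideLength i) * (expChar (p j) ξ * S j 0 ξ))
      = -∑ j ∈ Finset.univ.erase i, (P.sideLength j : ℂ) * (expChar (p j) ξ * S j 0 ξ) := by
    rw [← Finset.sum_neg_distrib]
    refine Finset.sum_congr rfl fun j _ => ?_
    field_simp
  rw [h3]
  linear_combination h

theorem schwartzConv_add_sum (f : 𝓢(ℝ, ℂ)) {ι : Type*} (s : Finset ι) {g : ℝ → ℂ}
    {R : ι → ℝ → ℂ} (C : ι → ℂ) (hg : HasSlowGrowth g) (hR : ∀ j ∈ s, HasSlowGrowth (R j))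
    (ξ : ℝ) : schwartzConv f (fun η => g η + ∑ j ∈ s, C j * R j η) ξ =
      schwartzConv f g ξ + ∑ j ∈ s, C j * schwartzConv f (R j) ξ := by
  have hi (j : ι) (hj : j ∈ s) : Integrable fun η => C j * (f (ξ - η) * R j η) :=
    ((hR j hj).integrable_sub_mul f ξ).const_mul _
  simp only [schwartzConv]
  simp_rw [← integral_const_mul]
  rw [← integral_finsetSum _ hi, ← integral_add (hg.integrable_sub_mul f ξ)
    (integrable_finsetSum _ hi)]
  congr 1
  funext η
  rw [mul_add, Finset.mul_sum]
  congr 1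
  exact Finset.sum_congr rfl fun j _ => mul_left_comm _ _ _

/-- The Neumann datum of a side is locally one order less regular than its Dirichlet datum. -/
theorem GlobalRelation.memSobolevLoc {n : ℕ} {P : Polygon ℂ n} (hP : P.IsConvexCCW) {β : ℝ}
    (hβ : 0 < β ^ 2) {q dq : Fin n → UnitDistribution} (hgr : GlobalRelation P β q dq)
    (i : Fin n) {s : ℝ} (hs : MemSobolev s 2 (q i).extend) : (dq i).MemSobolevLoc (s - 1) := by
  rw [memSobolev_extend_iff] at hs
  rw [memSobolevLoc_iff]
  intro φ hφ hφc hsupp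
  obtain ⟨S, M, p, C, hS, h⟩ := hgr.exists_fourierFun_eq hP hβ i
  have hL := hP.sideLength_pos i
  have hκ : 0 < 2 * |β| := by
    have : β ≠ 0 := by rintro rfl; simp at hβ
    positivity
  set t := 2 * Real.pi / P.sideLength i with ht
  have ht0 : 0 < t := by positivity
  set w : ℝ → ℂ := fun ξ => (√((t * ξ) ^ 2 + (2 * |β|) ^ 2) : ℝ) with hw
  have hwle (ξ : ℝ) : ‖w ξ‖ ≤ (t + 2 * |β|) * bracket ξ := by
    rw [hw, Complex.norm_real, Real.norm_of_nonneg (Real.sqrt_nonneg _)]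
    exact sqrt_le_mul_bracket ht0 hκ ξ
  have hwslow : HasSlowGrowth w := ⟨by fun_prop, _, 1, fun ξ => by
    rw [Real.rpow_one]
    exact hwle ξ⟩
  have hg := hwslow.mul (q i).hasSlowGrowth_fourierFun
  have hR (j : Fin n) (hj : j ∈ Finset.univ.erase i) :
      HasSlowGrowth fun ξ => expChar (p j) ξ * S j 0 ξ :=
    (hasSlowGrowth_expChar _).mul (hS j (Finset.ne_of_mem_erase hj)).1.hasSlowGrowth
  -- The multiplier is bounded by a multiple of ⟨ξ⟩, which is the loss of one order.
  have hgL : MemLp (fun ξ => ((bracket ξ ^ (s - 1) : ℝ) : ℂ) * (w ξ * (q i).fourierFun ξ)) 2 := by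
    refine (hs.const_mul ((t + 2 * |β| : ℝ) : ℂ)).mono
      ((hasTemperateGrowth_bracket_rpow _).1.continuous.mul hg.continuous).aestronglyMeasurable
      (.of_forall fun ξ => ?_)
    have hb := bracket_pos ξ
    simp only [norm_mul, Complex.norm_real]
    rw [Real.norm_of_nonneg (Real.rpow_nonneg hb.le _),
      Real.norm_of_nonneg (Real.rpow_nonneg hb.le _), Real.norm_of_nonneg (by positivity)]
    calc bracket ξ ^ (s - 1) * (‖w ξ‖ * ‖(q i).fourierFun ξ‖)
        ≤ bracket ξ ^ (s - 1) * ((t + 2 * |β|) * bracket ξ * ‖(q i).fourierFun ξ‖) := by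
          gcongr
          exact hwle ξ
      _ = (t + 2 * |β|) * (bracket ξ ^ (s - 1) * bracket ξ * ‖(q i).fourierFun ξ‖) := by ring
      _ = _ := by rw [← Real.rpow_add_one hb.ne', sub_add_cancel]
  have hmain := memLp_two_schwartzConv (𝓕 (hφc.toSchwartzMap hφ)) hg.continuous hgL
  -- The point p is 0 or 1, hence outside the support of φ, and the term is in H^r for every r; r =
  -- s - 1 is all that is needed.
  have hrest (j : Fin n) (hj : j ∈ Finset.univ.erase i) :=
    (memLp_two_schwartzConv_symbol hφ hφc (p := p j) (fun hmem => by
        have h01 := hsupp hmem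
        rcases (hS j (Finset.ne_of_mem_erase hj)).2 with h0 | h1
        · exact h01.1.ne' h0
        · exact h01.2.ne h1) (hS j (Finset.ne_of_mem_erase hj)).1.hasDerivAt
      (hS j (Finset.ne_of_mem_erase hj)).1.bound (s - 1)).const_mul (C j)
  refine (hmain.add (memLp_finsetSum _ hrest)).ae_eq (.of_forall fun ξ => ?_)
  have hD : (dq i).fourierFun = fun ξ => w ξ * (q i).fourierFun ξ +
      ∑ j ∈ Finset.univ.erase i, C j * (expChar (p j) ξ * S j 0 ξ) := funext h
  simp only [Pi.add_apply]
  rw [hD, schwartzConv_add_sum _ _ C hg hR, mul_add, Finset.mul_sum]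
  congr 1
  exact Finset.sum_congr rfl fun j _ => mul_left_comm _ _ _

end

theorem theorem4p1 {n : ℕ} (P : Polygon ℂ n) (hP : P.IsConvexCCW) (β : ℝ) (hβ : 0 < β ^ 2)
    (q dq : Fin n → UnitDistribution) (hgr : GlobalRelation P β q dq)
    (i : Fin n) (s : ℝ) (hs : TemperedDistribution.MemSobolev s 2 (q i).extend) :
    (dq i).MemSobolevLoc (s - 1) := by
  exact hgr.memSobolevLoc hP hβ i hs
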